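/- Let $a>-\frac14$, $a\neq 0$, $b>0$, and let $V:[0,\infty)\to\mathbb R$ be continuous and bounded. In $L^2(0,\infty)$ consider the operator $$[Au](r)=-u''(r)+\frac{a}{r^2}u(r)+br^2u(r)+V(r)u(r),\qquad \mathcal D(A)=C_c^\infty(0,\infty),$$ which is symmetric and bounded from below, and let $\mathcal A$ be its Friedrichs extension; whenever $A$ is essentially self-adjoint, $\mathcal A$ is the closure of $A$. (The Friedrichs extension is the restriction of the adjoint $A^*$ to those $u\in\mathcal D(A^*)$ for which there are $\varphi_n\in\mathcal D(A)$ with $\varphi_n\to u$ in $L^2$ and $\langle A(\varphi_n-\varphi_m),\varphi_n-\varphi_m\rangle\to0$ as $n,m\to\infty$.) Let $-\frac14<\alpha<a$ and $$Q(r)=\frac{a-\alpha}{r^2}+br^2+V(r),$$ so that $Au=-u''+\frac{\alpha}{r^2}u+Qu$, and write $Q=Q_+-Q_-$ on $(0,\infty)$ with $Q_\pm\ge 0$. Then for every real $\kappa\ge\frac32$ the number $\nu(\mathcal A)$ of negative eigenvalues of $\mathcal A$, counted with multiplicity, satisfies $$\nu(\mathcal A)\le\frac{(\kappa-1)^{\kappa-1}\,\Gamma(2\kappa)}{(4\alpha+1)^{\kappa-\frac12}\,\kappa^\kappa\,\Gamma(\kappa)^2}\int_0^\infty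 r^{2\kappa-1}Q_-(r)^\kappa\,dr,$$ where the integral takes values in $[0,\infty]$ (for $Q_-=\max(-Q,0)$ it is finite). -/

import Mathlib

open MeasureTheory Filter Topology Set
open scoped ENNReal NNReal InnerProductSpace Distributions LinearPMap

noncomputable section

namespace HalfLine

/-! ### Generalities on unbounded operators in a complex Hilbert space -/

section Abstract

variable {H : Type*} [NormedAddCommGroup H] [InnerProductSpace ℂ H]

/-- `T` is bounded from below: `Re ⟪T x, x⟫ ≥ -c ‖x‖²` on the domain of `T`, for some `c`. -/
def SemiboundedBelow (T : H →ₗ.[ℂ] H) : Prop :=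
  ∃ c : ℝ, ∀ x : T.domain, -c * ‖(x : H)‖ ^ 2 ≤ (⟪T x, (x : H)⟫_ℂ).re

/-- The quadratic form `x ↦ Re ⟪T x, x⟫` on the domain of `T`. -/
def quadForm (T : H →ₗ.[ℂ] H) (x : T.domain) : ℝ := (⟪T x, (x : H)⟫_ℂ).re

/-- `u` is the limit in `H` of a sequence in the domain of `T` that is Cauchy for the quadratic
form of `T`. -/
def IsFormLimit (T : H →ₗ.[ℂ] H) (u : H) : Prop :=
  ∃ φ : ℕ → T.domain, Tendsto (fun n => (φ n : H)) atTop (𝓝 u) ∧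
    Tendsto (fun p : ℕ × ℕ => quadForm T (φ p.1 - φ p.2)) atTop (𝓝 0)

theorem quadForm_add_le {T : H →ₗ.[ℂ] H} {c : ℝ}
    (hc : ∀ x : T.domain, -c * ‖(x : H)‖ ^ 2 ≤ (⟪T x, (x : H)⟫_ℂ).re) (x y : T.domain) :
    quadForm T (x + y) ≤ 2 * quadForm T x + 2 * quadForm T y + c * ‖(x - y : H)‖ ^ 2 := by
  have h := hc (x - y)
  have e : quadForm T (x + y) + (⟪T (x - y), ((x - y : T.domain) : H)⟫_ℂ).re
      = 2 * quadForm T x + 2 * quadForm T y := by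
    simp only [quadForm, LinearPMap.map_add, LinearPMap.map_sub, Submodule.coe_add,
      Submodule.coe_sub, inner_add_left, inner_add_right, inner_sub_left, inner_sub_right,
      Complex.add_re, Complex.sub_re]
    ring
  have e2 : ((x - y : T.domain) : H) = (x : H) - y := rfl
  rw [e2] at h e
  linarith

theorem quadForm_ge {T : H →ₗ.[ℂ] H} {c : ℝ}
    (hc : ∀ x : T.domain, -c * ‖(x : H)‖ ^ 2 ≤ (⟪T x, (x : H)⟫_ℂ).re) (x : T.domain) :
    -c * ‖(x : H)‖ ^ 2 ≤ quadForm T x := hc x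

theorem IsFormLimit.add {T : H →ₗ.[ℂ] H} (hT : SemiboundedBelow T) {u v : H}
    (hu : IsFormLimit T u) (hv : IsFormLimit T v) : IsFormLimit T (u + v) := by
  obtain ⟨c, hc⟩ := hT
  obtain ⟨φ, hφ, hφq⟩ := hu
  obtain ⟨ψ, hψ, hψq⟩ := hv
  refine ⟨fun n => φ n + ψ n, by simpa using hφ.add hψ, ?_⟩
  have f1 : Tendsto (Prod.fst : ℕ × ℕ → ℕ) atTop atTop := by
    rw [← prod_atTop_atTop_eq]; exact tendsto_fst
  have f2 : Tendsto (Prod.snd : ℕ × ℕ → ℕ) atTop atTop := by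
    rw [← prod_atTop_atTop_eq]; exact tendsto_snd
  have dφ : Tendsto (fun p : ℕ × ℕ => (φ p.1 : H) - φ p.2) atTop (𝓝 0) := by
    simpa using (hφ.comp f1).sub (hφ.comp f2)
  have dψ : Tendsto (fun p : ℕ × ℕ => (ψ p.1 : H) - ψ p.2) atTop (𝓝 0) := by
    simpa using (hψ.comp f1).sub (hψ.comp f2)
  have lo : Tendsto (fun p : ℕ × ℕ =>
      -c * ‖((φ p.1 : H) - φ p.2) + ((ψ p.1 : H) - ψ p.2)‖ ^ 2) atTop (𝓝 0) := by
    simpa using ((dφ.add dψ).norm.pow 2).const_mul (-c)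
  have hi : Tendsto (fun p : ℕ × ℕ => 2 * quadForm T (φ p.1 - φ p.2)
      + 2 * quadForm T (ψ p.1 - ψ p.2)
      + c * ‖((φ p.1 : H) - φ p.2) - ((ψ p.1 : H) - ψ p.2)‖ ^ 2) atTop (𝓝 0) := by
    simpa using ((hφq.const_mul 2).add (hψq.const_mul 2)).add
      (((dφ.sub dψ).norm.pow 2).const_mul c)
  refine tendsto_of_tendsto_of_tendsto_of_le_of_le lo hi (fun p => ?_) (fun p => ?_)
  · have := quadForm_ge hc ((φ p.1 - φ p.2) + (ψ p.1 - ψ p.2))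
    rw [show φ p.1 + ψ p.1 - (φ p.2 + ψ p.2) = (φ p.1 - φ p.2) + (ψ p.1 - ψ p.2) by abel]
    exact this
  · have := quadForm_add_le hc (φ p.1 - φ p.2) (ψ p.1 - ψ p.2)
    dsimp only
    rw [show φ p.1 + ψ p.1 - (φ p.2 + ψ p.2) = (φ p.1 - φ p.2) + (ψ p.1 - ψ p.2) by abel]
    exact this

theorem IsFormLimit.smul {T : H →ₗ.[ℂ] H} (z : ℂ) {u : H}
    (hu : IsFormLimit T u) : IsFormLimit T (z • u) := by
  obtain ⟨φ, hφ, hφq⟩ := hu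
  refine ⟨fun n => z • φ n, by simpa using hφ.const_smul z, ?_⟩
  have : ∀ p : ℕ × ℕ, quadForm T (z • φ p.1 - z • φ p.2)
      = ‖z‖ ^ 2 * quadForm T (φ p.1 - φ p.2) := by
    intro p
    rw [← smul_sub]
    simp only [quadForm, LinearPMap.map_smul, Submodule.coe_smul, inner_smul_left,
      inner_smul_right]
    rw [← mul_assoc, mul_comm z, Complex.conj_mul', ← Complex.ofReal_pow, Complex.re_ofReal_mul]
  simp only [this]
  simpa using hφq.const_mul (‖z‖ ^ 2)

/-- The form domain of a semibounded operator: the domain of the closure of its quadratic form. -/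
def formDomain (T : H →ₗ.[ℂ] H) (hT : SemiboundedBelow T) : Submodule ℂ H where
  carrier := {u | IsFormLimit T u}
  zero_mem' := ⟨fun _ => 0, by simp, by simp [quadForm]⟩
  add_mem' := IsFormLimit.add hT
  smul_mem' z _ := IsFormLimit.smul z

/-- The Friedrichs extension of a densely defined semibounded symmetric operator `T`: the
restriction of the adjoint `T†` to the vectors that lie in the form domain of `T`. -/
def friedrichs [CompleteSpace H] (T : H →ₗ.[ℂ] H) (hT : SemiboundedBelow T) : H →ₗ.[ℂ] H :=
  T†.domRestrict (formDomain T hT)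

/-- The eigenspace `{u ∈ D(T) | T u = μ u}`. -/
def eigenspace (T : H →ₗ.[ℂ] H) (μ : ℂ) : Submodule ℂ H :=
  (LinearMap.ker (T.toFun - μ • T.domain.subtype)).map T.domain.subtype

/-- The number of negative eigenvalues of `T`, counted with multiplicity: the dimension of the
span of all the eigenvectors that belong to negative eigenvalues. -/
def numNegEigenvalues (T : H →ₗ.[ℂ] H) : ℕ∞ :=
  Cardinal.toENat (Module.rank ℂ (⨆ μ : Iio (0 : ℝ), eigenspace T ((μ : ℝ) : ℂ) : Submodule ℂ H))

end Abstract

/-! ### The operator on the half-line -/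

/-- The open half-line `(0, ∞)`. -/
def halfLine : TopologicalSpace.Opens ℝ := ⟨Ioi 0, isOpen_Ioi⟩

/-- The Hilbert space `L²(0, ∞)` of complex-valued functions. -/
abbrev L2 : Type := Lp ℂ 2 (volume.restrict (Ioi (0 : ℝ)))

/-- The complex-valued functions in `C_c^∞(0, ∞)`. -/
abbrev Test : Type := 𝓓(halfLine, ℂ)

/-- The potential `a / r² + b r² + V(r)`. -/
def potential (a b : ℝ) (V : ℝ → ℝ) (r : ℝ) : ℝ := a / r ^ 2 + b * r ^ 2 + V r

/-- The differential expression `-u'' + (a / r² + b r² + V(r)) u`. -/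
def expr (a b : ℝ) (V : ℝ → ℝ) (u : ℝ → ℂ) (r : ℝ) : ℂ :=
  -deriv (deriv u) r + (potential a b V r : ℂ) * u r

theorem potential_continuousOn (a b : ℝ) {V : ℝ → ℝ} (hV : ContinuousOn V (Ici 0)) :
    ContinuousOn (potential a b V) (Ioi 0) := by
  unfold potential
  refine ContinuousOn.add (ContinuousOn.add ?_ ?_) (hV.mono Ioi_subset_Ici_self)
  · exact continuousOn_const.div (by fun_prop) fun x hx => pow_ne_zero _ (ne_of_gt hx)
  · fun_prop

/-- A function that is continuous on `(0, ∞)` and vanishes off the support of a test function is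
continuous on the whole line. -/
theorem continuous_of_zero_off {E : Type*} [NormedAddCommGroup E] (φ : Test) {g : ℝ → E}
    (hg : ContinuousOn g (Ioi 0)) (h0 : ∀ r ∉ tsupport φ, g r = 0) : Continuous g := by
  rw [continuous_iff_continuousAt]
  intro r
  by_cases hr : r ∈ tsupport φ
  · have : r ∈ Ioi (0 : ℝ) := φ.tsupport_subset hr
    exact hg.continuousAt (isOpen_Ioi.mem_nhds this)
  · have : g =ᶠ[𝓝 r] fun _ => 0 := by
      filter_upwards [(isClosed_tsupport φ).isOpen_compl.mem_nhds hr] with x hx using h0 x hx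
    exact continuousAt_const.congr this.symm

theorem hasCompactSupport_of_zero_off {E : Type*} [NormedAddCommGroup E] (φ : Test) {g : ℝ → E}
    (h0 : ∀ r ∉ tsupport φ, g r = 0) : HasCompactSupport g :=
  HasCompactSupport.intro φ.hasCompactSupport h0

theorem test_zero_off (φ : Test) {r : ℝ} (hr : r ∉ tsupport φ) :
    φ r = 0 ∧ deriv φ r = 0 ∧ deriv (deriv φ) r = 0 :=
  ⟨image_eq_zero_of_notMem_tsupport hr,
    image_eq_zero_of_notMem_tsupport fun h => hr (tsupport_deriv_subset h),
    image_eq_zero_of_notMem_tsupport fun h =>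
      hr (tsupport_deriv_subset (tsupport_deriv_subset h))⟩

theorem test_contDiff (φ : Test) : ContDiff ℝ 2 φ := φ.contDiff.of_le (by
  rw [show (2 : WithTop ℕ∞) = ((2 : ℕ∞) : WithTop ℕ∞) from rfl]; exact WithTop.coe_le_coe.2 le_top)

theorem test_contDiff_deriv (φ : Test) : ContDiff ℝ 1 (deriv φ) :=
  (contDiff_succ_iff_deriv (n := 1)).1 (test_contDiff φ) |>.2.2

theorem test_hasDerivAt (φ : Test) (r : ℝ) : HasDerivAt φ (deriv φ r) r :=
  ((test_contDiff φ).differentiable (by norm_num) r).hasDerivAt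

theorem test_hasDerivAt_deriv (φ : Test) (r : ℝ) :
    HasDerivAt (deriv φ) (deriv (deriv φ) r) r :=
  ((test_contDiff_deriv φ).differentiable (by norm_num) r).hasDerivAt

theorem test_continuous_deriv2 (φ : Test) : Continuous (deriv (deriv φ)) :=
  (test_contDiff_deriv φ).continuous_deriv le_rfl

theorem expr_zero_off (a b : ℝ) (V : ℝ → ℝ) (φ : Test) {r : ℝ} (hr : r ∉ tsupport φ) :
    expr a b V φ r = 0 := by
  obtain ⟨h0, -, h2⟩ := test_zero_off φ hr
  simp [expr, h0, h2]

theorem expr_continuous (a b : ℝ) {V : ℝ → ℝ} (hV : ContinuousOn V (Ici 0)) (φ : Test) :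
    Continuous (expr a b V φ) := by
  refine continuous_of_zero_off φ ?_ fun r hr => expr_zero_off a b V φ hr
  exact (test_continuous_deriv2 φ).continuousOn.neg.add
    ((Complex.continuous_ofReal.comp_continuousOn (potential_continuousOn a b hV)).mul
      φ.continuous.continuousOn)

theorem memLp_test (φ : Test) : MemLp φ 2 (volume.restrict (Ioi (0 : ℝ))) :=
  φ.continuous.memLp_of_hasCompactSupport φ.hasCompactSupport

theorem memLp_expr (a b : ℝ) {V : ℝ → ℝ} (hV : ContinuousOn V (Ici 0)) (φ : Test) :
    MemLp (expr a b V φ) 2 (volume.restrict (Ioi (0 : ℝ))) :=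
  (expr_continuous a b hV φ).memLp_of_hasCompactSupport
    (hasCompactSupport_of_zero_off φ fun _ hr => expr_zero_off a b V φ hr)

/-- The embedding of `C_c^∞(0, ∞)` in `L²(0, ∞)`. -/
def testToL2 : Test →ₗ[ℂ] L2 where
  toFun φ := (memLp_test φ).toLp φ
  map_add' _ _ := rfl
  map_smul' _ _ := rfl

theorem testToL2_injective : Function.Injective testToL2 := by
  intro φ ψ h
  have h1 : φ =ᵐ[volume.restrict (Ioi (0 : ℝ))] ψ :=
    (MemLp.toLp_eq_toLp_iff (memLp_test φ) (memLp_test ψ)).1 h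
  have h2 := Measure.eqOn_open_of_ae_eq h1 isOpen_Ioi φ.continuous.continuousOn
    ψ.continuous.continuousOn
  refine TestFunction.ext fun r => ?_
  by_cases hr : r ∈ Ioi (0 : ℝ)
  · exact h2 hr
  · rw [(test_zero_off φ fun h => hr (φ.tsupport_subset h)).1,
      (test_zero_off ψ fun h => hr (ψ.tsupport_subset h)).1]

theorem expr_add (a b : ℝ) (V : ℝ → ℝ) (φ ψ : Test) :
    expr a b V (φ + ψ : Test) = expr a b V φ + expr a b V ψ := by
  have h1 : deriv (φ + ψ : Test) = deriv φ + deriv ψ :=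
    funext fun r => ((test_hasDerivAt φ r).add (test_hasDerivAt ψ r)).deriv
  have h2 : deriv (deriv φ + deriv ψ) = deriv (deriv φ) + deriv (deriv ψ) :=
    funext fun r => ((test_hasDerivAt_deriv φ r).add (test_hasDerivAt_deriv ψ r)).deriv
  funext r
  have h3 : (φ + ψ : Test) r = φ r + ψ r := rfl
  simp only [expr, h1, h2, h3, Pi.add_apply]
  ring

theorem expr_smul (a b : ℝ) (V : ℝ → ℝ) (z : ℂ) (φ : Test) :
    expr a b V (z • φ : Test) = z • expr a b V φ := by
  have h1 : deriv (z • φ : Test) = z • deriv φ :=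
    funext fun r => ((test_hasDerivAt φ r).const_smul z).deriv
  have h2 : deriv (z • deriv φ) = z • deriv (deriv φ) :=
    funext fun r => ((test_hasDerivAt_deriv φ r).const_smul z).deriv
  funext r
  have h3 : (z • φ : Test) r = z • φ r := rfl
  simp only [expr, h1, h2, h3, Pi.smul_apply, smul_eq_mul]
  ring

/-- The map `φ ↦ -φ'' + (a / r² + b r² + V) φ` from `C_c^∞(0, ∞)` to `L²(0, ∞)`. -/
def exprToL2 (a b : ℝ) (V : ℝ → ℝ) (hV : ContinuousOn V (Ici 0)) : Test →ₗ[ℂ] L2 where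
  toFun φ := (memLp_expr a b hV φ).toLp (expr a b V φ)
  map_add' φ ψ := by
    rw [← MemLp.toLp_add]
    exact MemLp.toLp_congr _ _ (Eventually.of_forall fun r => by rw [expr_add])
  map_smul' z φ := by
    rw [RingHom.id_apply, ← MemLp.toLp_const_smul]
    exact MemLp.toLp_congr _ _ (Eventually.of_forall fun r => by rw [expr_smul])

/-- The operator `A u = -u'' + (a / r²) u + b r² u + V u` in `L²(0, ∞)` with domain
`C_c^∞(0, ∞)`. -/
def minimalOp (a b : ℝ) (V : ℝ → ℝ) (hV : ContinuousOn V (Ici 0)) : L2 →ₗ.[ℂ] L2 where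
  domain := LinearMap.range testToL2
  toFun := (exprToL2 a b V hV).comp
    (LinearEquiv.ofInjective testToL2 testToL2_injective).symm.toLinearMap

/-- `A` acts on test functions by the differential expression. -/
theorem minimalOp_apply (a b : ℝ) (V : ℝ → ℝ) (hV : ContinuousOn V (Ici 0)) (φ : Test) :
    minimalOp a b V hV ⟨testToL2 φ, LinearMap.mem_range_self _ φ⟩ = exprToL2 a b V hV φ := by
  have h : (LinearEquiv.ofInjective testToL2 testToL2_injective).symm
      ⟨testToL2 φ, LinearMap.mem_range_self _ φ⟩ = φ :=
    (LinearEquiv.symm_apply_eq _).2 rfl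
  exact congrArg (exprToL2 a b V hV) h

/-- Hardy's inequality in local form: `Re ((-u'') ū) - |u|² / (4 r²)` is at least a derivative. -/
theorem hardy_pointwise (u v w : ℂ) {r : ℝ} (hr : 0 < r) :
    ‖u‖ ^ 2 / (4 * r ^ 2) + (-(⟪v, v⟫_ℝ + ⟪w, u⟫_ℝ)
      + ((⟪u, v⟫_ℝ + ⟪v, u⟫_ℝ) * (1 / (2 * r)) + ⟪u, u⟫_ℝ * (-1 / (2 * r ^ 2))))
      ≤ ⟪-w, u⟫_ℝ := by
  have h : 0 ≤ ‖v - (1 / (2 * r)) • u‖ ^ 2 := sq_nonneg _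
  rw [← real_inner_self_eq_norm_sq] at h ⊢
  simp only [inner_sub_left, inner_sub_right, real_inner_smul_left, real_inner_smul_right] at h
  rw [inner_neg_left]
  generalize ⟪u, u⟫_ℝ = x at *
  have e : (1 / (2 * r)) * (1 / (2 * r) * x) = x / (4 * r ^ 2) := by
    field_simp; ring
  have e2 : x * (-1 / (2 * r ^ 2)) = -2 * (x / (4 * r ^ 2)) := by
    field_simp; norm_num
  rw [e] at h
  rw [e2]
  linarith

/-- The derivative of `-⟪φ', φ⟫ + |φ|² / (2 r)`. -/
def hardyDeriv (φ : Test) (r : ℝ) : ℝ :=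
  -(⟪deriv φ r, deriv φ r⟫_ℝ + ⟪deriv (deriv φ) r, φ r⟫_ℝ)
    + ((⟪φ r, deriv φ r⟫_ℝ + ⟪deriv φ r, φ r⟫_ℝ) * (1 / (2 * r))
      + ⟪φ r, φ r⟫_ℝ * (-1 / (2 * r ^ 2)))

theorem hardyDeriv_zero_off (φ : Test) {r : ℝ} (hr : r ∉ tsupport φ) : hardyDeriv φ r = 0 := by
  obtain ⟨h0, h1, -⟩ := test_zero_off φ hr
  simp [hardyDeriv, h0, h1]

theorem hardyDeriv_continuous (φ : Test) : Continuous (hardyDeriv φ) := by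
  refine continuous_of_zero_off φ ?_ fun r hr => hardyDeriv_zero_off φ hr
  have c0 : ContinuousOn φ (Ioi 0) := φ.continuous.continuousOn
  have c1 : ContinuousOn (deriv φ) (Ioi 0) := (test_contDiff_deriv φ).continuous.continuousOn
  have c2 : ContinuousOn (deriv (deriv φ)) (Ioi 0) := (test_continuous_deriv2 φ).continuousOn
  have d1 : ContinuousOn (fun r : ℝ => 1 / (2 * r)) (Ioi 0) :=
    continuousOn_const.div (by fun_prop) fun x hx => by
      have : (0 : ℝ) < x := hx
      positivity
  have d2 : ContinuousOn (fun r : ℝ => -1 / (2 * r ^ 2)) (Ioi 0) :=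
    continuousOn_const.div (by fun_prop) fun x hx => by
      have : (0 : ℝ) < x := hx
      positivity
  exact ((c1.inner c1).add (c2.inner c0)).neg.add
    ((((c0.inner c1).add (c1.inner c0)).mul d1).add ((c0.inner c0).mul d2))

theorem hardyDeriv_integrable (φ : Test) : Integrable (hardyDeriv φ) :=
  (hardyDeriv_continuous φ).integrable_of_hasCompactSupport
    (hasCompactSupport_of_zero_off φ fun _ hr => hardyDeriv_zero_off φ hr)

theorem hardyDeriv_setIntegral (φ : Test) : ∫ r in Ioi (0 : ℝ), hardyDeriv φ r = 0 := by
  have hz : ∀ r : ℝ, r ∉ Ioi (0 : ℝ) → hardyDeriv φ r = 0 := fun r hr =>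
    hardyDeriv_zero_off φ fun h => hr (φ.tsupport_subset h)
  rw [setIntegral_eq_integral_of_forall_compl_eq_zero hz]
  set G : ℝ → ℝ := fun r => -⟪deriv φ r, φ r⟫_ℝ + ⟪φ r, φ r⟫_ℝ * (1 / (2 * r)) with hG
  have G0 : ∀ r ∉ tsupport φ, G r = 0 := fun r hr => by
    simp [hG, (test_zero_off φ hr).1]
  have hd : ∀ r, HasDerivAt G (hardyDeriv φ r) r := by
    intro r
    by_cases hr : r ∈ tsupport φ
    · have hr0 : (0 : ℝ) < r := φ.tsupport_subset hr
      have h1 := (test_hasDerivAt_deriv φ r).inner ℝ (test_hasDerivAt φ r)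
      have h2 := (test_hasDerivAt φ r).inner ℝ (test_hasDerivAt φ r)
      have h3 : HasDerivAt (fun r : ℝ => 1 / (2 * r)) (-1 / (2 * r ^ 2)) r := by
        have h4 : HasDerivAt (fun r : ℝ => 2 * r) 2 r := by
          simpa using (hasDerivAt_id r).const_mul 2
        have h5 := h4.fun_inv (by positivity)
        have e1 : (fun r : ℝ => 1 / (2 * r)) = fun r => (2 * r)⁻¹ := by
          funext x; rw [one_div]
        have e2 : -1 / (2 * r ^ 2) = -2 / (2 * r) ^ 2 := by
          field_simp
        rw [e1, e2]
        exact h5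
      exact h1.neg.add (h2.mul h3)
    · rw [hardyDeriv_zero_off φ hr]
      have : G =ᶠ[𝓝 r] fun _ => 0 := by
        filter_upwards [(isClosed_tsupport φ).isOpen_compl.mem_nhds hr] with x hx using G0 x hx
      exact (hasDerivAt_const r (0 : ℝ)).congr_of_eventuallyEq this
  have Gc : Continuous G := continuous_iff_continuousAt.2 fun r => (hd r).continuousAt
  exact integral_eq_zero_of_hasDerivAt_of_integrable hd (hardyDeriv_integrable φ)
    (Gc.integrable_of_hasCompactSupport (hasCompactSupport_of_zero_off φ G0))

/-- By Hardy's inequality, `A` is bounded from below. -/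
theorem minimalOp_semibounded {a b : ℝ} (ha : -(1 / 4) < a) (hb : 0 < b) {V : ℝ → ℝ}
    (hV : ContinuousOn V (Ici 0)) (hVb : ∃ M, ∀ r ∈ Ici (0 : ℝ), |V r| ≤ M) :
    SemiboundedBelow (minimalOp a b V hV) := by
  obtain ⟨M, hM⟩ := hVb
  refine ⟨M, ?_⟩
  rintro ⟨_, φ, rfl⟩
  rw [minimalOp_apply]
  have hφ : ⇑(testToL2 φ) =ᵐ[volume.restrict (Ioi (0 : ℝ))] φ := (memLp_test φ).coeFn_toLp
  have hA : ⇑(exprToL2 a b V hV φ) =ᵐ[volume.restrict (Ioi (0 : ℝ))] expr a b V φ :=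
    (memLp_expr a b hV φ).coeFn_toLp
  have hn : ‖testToL2 φ‖ ^ 2 = ∫ r in Ioi (0 : ℝ), ‖φ r‖ ^ 2 := by
    have h := inner_self_eq_norm_sq (𝕜 := ℂ) (testToL2 φ)
    rw [← h, MeasureTheory.L2.inner_def, ← integral_re (L2.integrable_inner _ _)]
    refine integral_congr_ae ?_
    filter_upwards [hφ] with r hr
    rw [hr, inner_self_eq_norm_sq]
  have hi : (⟪exprToL2 a b V hV φ, testToL2 φ⟫_ℂ).re
      = ∫ r in Ioi (0 : ℝ), ⟪expr a b V φ r, φ r⟫_ℝ := by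
    change RCLike.re (⟪exprToL2 a b V hV φ, testToL2 φ⟫_ℂ) = _
    rw [MeasureTheory.L2.inner_def, ← integral_re (L2.integrable_inner _ _)]
    refine integral_congr_ae ?_
    filter_upwards [hφ, hA] with r h1 h2
    rw [h1, h2]
    rfl
  have i1 : IntegrableOn (fun r => ⟪expr a b V φ r, φ r⟫_ℝ) (Ioi 0) := by
    refine (Continuous.integrable_of_hasCompactSupport
      ((expr_continuous a b hV φ).inner φ.continuous)
      (hasCompactSupport_of_zero_off φ fun r hr => ?_)).integrableOn
    rw [(test_zero_off φ hr).1, inner_zero_right]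
  have i2 : IntegrableOn (fun r => ‖φ r‖ ^ 2) (Ioi 0) := by
    refine (Continuous.integrable_of_hasCompactSupport (φ.continuous.norm.pow 2)
      (hasCompactSupport_of_zero_off φ fun r hr => ?_)).integrableOn
    simp [(test_zero_off φ hr).1]
  change -M * ‖testToL2 φ‖ ^ 2 ≤ (⟪exprToL2 a b V hV φ, testToL2 φ⟫_ℂ).re
  rw [hi, hn]
  have key : ∫ r in Ioi (0 : ℝ), (hardyDeriv φ r + -M * ‖φ r‖ ^ 2)
      ≤ ∫ r in Ioi (0 : ℝ), ⟪expr a b V φ r, φ r⟫_ℝ := by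
    refine setIntegral_mono_on ((hardyDeriv_integrable φ).integrableOn.add (i2.const_mul _)) i1
      measurableSet_Ioi fun r hr => ?_
    have hr0 : (0 : ℝ) < r := hr
    have h1 := hardy_pointwise (φ r) (deriv φ r) (deriv (deriv φ) r) hr0
    have h2 : ⟪expr a b V φ r, φ r⟫_ℝ
        = ⟪-deriv (deriv φ) r, φ r⟫_ℝ + potential a b V r * ‖φ r‖ ^ 2 := by
      have : (potential a b V r : ℂ) * φ r = potential a b V r • φ r := by simp
      rw [expr, this, inner_add_left, real_inner_smul_left, real_inner_self_eq_norm_sq]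
    have h3 : -M * ‖φ r‖ ^ 2
        ≤ ‖φ r‖ ^ 2 / (4 * r ^ 2) + potential a b V r * ‖φ r‖ ^ 2 := by
      have hv := (abs_le.1 (hM r (le_of_lt hr0))).1
      have h4 : -M ≤ 1 / (4 * r ^ 2) + potential a b V r := by
        have h5 : 0 ≤ (a + 1 / 4) / r ^ 2 := div_nonneg (by linarith) (by positivity)
        have h6 : (a + 1 / 4) / r ^ 2 = 1 / (4 * r ^ 2) + a / r ^ 2 := by
          field_simp; ring
        have h7 : 0 ≤ b * r ^ 2 := by positivity
        rw [potential]
        linarith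
      calc -M * ‖φ r‖ ^ 2 ≤ (1 / (4 * r ^ 2) + potential a b V r) * ‖φ r‖ ^ 2 :=
            mul_le_mul_of_nonneg_right h4 (sq_nonneg _)
        _ = _ := by ring
    have h8 : hardyDeriv φ r + ‖φ r‖ ^ 2 / (4 * r ^ 2) ≤ ⟪-deriv (deriv φ) r, φ r⟫_ℝ := by
      rw [hardyDeriv]; linarith
    rw [h2]
    linarith
  rw [integral_add (hardyDeriv_integrable φ).integrableOn (i2.const_mul _),
    hardyDeriv_setIntegral, integral_const_mul, zero_add] at key
  exact key

end HalfLine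

end

/-! The count rests on a sharp statement about a single well. Let C be the constant of the bound. If
C ∫ r^(2κ-1) q^κ ≤ 1 on an interval [x, y] with 0 < x, then the form of -d²/dr² + α/r² - q is
nonnegative on functions vanishing at x and y (`dirichlet_form_nonneg`). To see this, put f = √r w,
which turns the form into ∫ r w'² + m² w²/r - r q w² with m² = α + 1/4, and normalize max |w| = 1.
Young's inequality separates q from w, at the price of replacing w² by w² - |w|^(2κ/(κ-1)) = W(w)².
Completing the square gives r w'² + m² W(w)²/r ≥ 2m |w'| W(w). Since w runs from 0 to ±1 and back,
the right side integrates to at least 4m ∫₀¹ W, which is a Beta integral. This is where the Gamma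
functions come from (`energy_lower_bound`, `integral_sobolevWeight`).

Suppose now that the form is negative on an n-dimensional space of test functions although C ∫
r^(2κ-1) q^κ < n. Cut an interval containing all the supports into n pieces, each of mass at most
1/C. Some nonzero function of the space vanishes at the n - 1 interior cuts, and its form is a sum
of n nonnegative terms, a contradiction (`card_le_of_form_neg`).

It remains to pass from eigenvectors to test functions. Eigenvectors lie in the form domain, so
orthonormal ones for negative eigenvalues are limits of form-Cauchy sequences of test functions. The
form matrices of these sequences converge to the diagonal matrix of the eigenvalues, hence become
negative definite (`exists_quadForm_neg`). Only two properties of the extension enter: it is a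
restriction of the adjoint, and its domain lies in the form domain. The Friedrichs extension and the
closure both have them. -/

noncomputable section

namespace HalfLine

/-! ### The sharp Sobolev inequality on an interval -/

/-- Young's inequality in the form that is dual to `x ↦ t * x ^ (κ / (κ - 1))`. -/
theorem mul_le_rpow_add_rpow {κ t x U : ℝ} (hκ : 1 < κ) (ht : 0 < t) (hx : 0 ≤ x) (hU : 0 ≤ U) :
    x * U ≤ t * x ^ (κ / (κ - 1)) + (κ - 1) ^ (κ - 1) / κ ^ κ * t ^ (1 - κ) * U ^ κ := by
  have hκ0 : 0 < κ := by linarith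
  have hκ1 : 0 < κ - 1 := by linarith
  set p : ℝ := κ / (κ - 1) with hp
  have hp0 : 0 < p := by positivity
  have hpq : p.HolderConjugate κ := (Real.HolderConjugate.conjExponent hκ).symm
  -- Young's inequality divides the p-th power by p. Scaling x by (t p)^(1/p) turns that coefficient
  -- into t, and the inverse scaling of U preserves the product.
  set s : ℝ := t * p with hs
  have hs0 : 0 < s := by positivity
  have h := Real.young_inequality_of_nonneg (a := s ^ (1 / p) * x) (b := s ^ (-(1 / p)) * U)
    (by positivity) (by positivity) hpq
  have e1 : s ^ (1 / p) * x * (s ^ (-(1 / p)) * U) = x * U := by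
    rw [Real.rpow_neg hs0.le]
    field_simp
  have e2 : (s ^ (1 / p) * x) ^ p / p = t * x ^ p := by
    rw [Real.mul_rpow (by positivity) hx, ← Real.rpow_mul hs0.le, one_div_mul_cancel hp0.ne',
      Real.rpow_one, hs]
    field_simp
  have e3 : (s ^ (-(1 / p)) * U) ^ κ / κ = (κ - 1) ^ (κ - 1) / κ ^ κ * t ^ (1 - κ) * U ^ κ := by
    have e4 : -(1 / p) * κ = 1 - κ := by
      rw [hp]; field_simp; ring
    have e5 : p ^ (1 - κ) = (κ - 1) ^ (κ - 1) / κ ^ κ * κ := by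
      rw [hp, Real.div_rpow hκ0.le hκ1.le, Real.rpow_sub hκ0, Real.rpow_one,
        show 1 - κ = -(κ - 1) by ring, Real.rpow_neg hκ1.le]
      field_simp
    rw [Real.mul_rpow (by positivity) hU, ← Real.rpow_mul hs0.le, e4, hs,
      Real.mul_rpow ht.le hp0.le, e5]
    field_simp
  rw [e1, e2, e3] at h
  exact h

/-- The weight `s ↦ |s| √(1 - |s| ^ (2 / (κ - 1)))`. -/
def sobolevWeight (κ s : ℝ) : ℝ := |s| * √(1 - (s ^ 2) ^ (1 / (κ - 1)))

theorem continuous_sobolevWeight {κ : ℝ} (hκ : 1 < κ) : Continuous (sobolevWeight κ) := by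
  have h : 0 ≤ 1 / (κ - 1) := by
    have : 0 < κ - 1 := by linarith
    positivity
  unfold sobolevWeight
  exact continuous_abs.mul
    (continuous_const.sub ((continuous_pow 2).rpow_const fun _ => Or.inr h)).sqrt

theorem sobolevWeight_nonneg (κ s : ℝ) : 0 ≤ sobolevWeight κ s := by
  unfold sobolevWeight; positivity

/-- Young's inequality leaves exactly this difference of powers, so the weight is the square root
needed to complete the square in the energy. The bound |s| ≤ 1 keeps the radicand nonnegative. -/
theorem sobolevWeight_sq {κ s : ℝ} (hκ : 1 < κ) (hs : |s| ≤ 1) :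
    sobolevWeight κ s ^ 2 = s ^ 2 - (s ^ 2) ^ (κ / (κ - 1)) := by
  have h0 : 0 < κ - 1 := by linarith
  have hs2 : s ^ 2 ≤ 1 := by rw [← sq_abs]; exact pow_le_one₀ (abs_nonneg s) hs
  have h1 : (s ^ 2) ^ (1 / (κ - 1)) ≤ 1 :=
    Real.rpow_le_one (sq_nonneg s) hs2 (by positivity)
  have h2 : (s ^ 2) ^ (κ / (κ - 1)) = s ^ 2 * (s ^ 2) ^ (1 / (κ - 1)) := by
    rw [show κ / (κ - 1) = 1 + 1 / (κ - 1) by field_simp; ring,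
      Real.rpow_add_of_nonneg (sq_nonneg s) zero_le_one (by positivity), Real.rpow_one]
  rw [sobolevWeight, mul_pow, Real.sq_sqrt (by linarith), sq_abs, h2]
  ring

/-! ### The Beta integral behind the constant -/

theorem integral_rpow_mul_sqrt {u : ℝ} (hu : 0 < u) :
    ∫ t in Ioo (0 : ℝ) 1, t ^ (u - 1) * √(1 - t)
      = Real.Gamma u * Real.Gamma (3 / 2) / Real.Gamma (u + 3 / 2) := by
  have h := ProbabilityTheory.beta_eq_betaIntegralReal u (3 / 2) hu (by norm_num)
  rw [ProbabilityTheory.beta] at h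
  rw [h, Complex.betaIntegral, intervalIntegral.integral_of_le zero_le_one,
    ← integral_Ioc_eq_integral_Ioo]
  have e : ∀ t ∈ Ioc (0 : ℝ) 1, (t : ℂ) ^ ((u : ℂ) - 1) * (1 - (t : ℂ)) ^ (((3 / 2 : ℝ) : ℂ) - 1)
      = ((t ^ (u - 1) * √(1 - t) : ℝ) : ℂ) := by
    intro t ht
    rw [Complex.ofReal_mul, Complex.ofReal_cpow ht.1.le, Real.sqrt_eq_rpow,
      Complex.ofReal_cpow (by linarith [ht.2])]
    push_cast
    norm_num
  rw [setIntegral_congr_fun measurableSet_Ioc e, integral_complex_ofReal, Complex.ofReal_re]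

/-- The substitution t = s^(2/(κ-1)) gives (κ-1)/2 times the Beta integral B(κ-1, 3/2). Legendre's
duplication formula then replaces Γ(κ+1/2) by Γ(2κ)/Γ(κ). -/
theorem integral_sobolevWeight {κ : ℝ} (hκ : 1 < κ) :
    4 * ∫ s in (0 : ℝ)..1, sobolevWeight κ s
      = Real.Gamma κ ^ 2 * 2 ^ (2 * κ - 1) / Real.Gamma (2 * κ) := by
  have h0 : 0 < κ - 1 := by linarith
  set p : ℝ := 2 / (κ - 1) with hp
  have hp0 : 0 < p := by positivity
  have h1 : ∫ s in (0 : ℝ)..1, sobolevWeight κ s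
      = (κ - 1) / 2 * ∫ t in Ioo (0 : ℝ) 1, t ^ (κ - 1 - 1) * √(1 - t) := by
    -- The power substitution is a formula on (0, ∞). The indicator restricts it to (0, 1), which s
    -- ↦ s^p preserves.
    have h2 := integral_comp_rpow_Ioi_of_pos
      (g := (Ioo (0 : ℝ) 1).indicator fun t => t ^ (κ - 1 - 1) * √(1 - t)) hp0
    rw [setIntegral_indicator measurableSet_Ioo,
      inter_eq_right.2 (Ioo_subset_Ioi_self : Ioo (0 : ℝ) 1 ⊆ Ioi 0)] at h2
    have h3 : ∫ s in Ioo (0 : ℝ) 1, sobolevWeight κ s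
        = ∫ s in Ioi (0 : ℝ), (Ioo (0 : ℝ) 1).indicator (sobolevWeight κ) s := by
      rw [setIntegral_indicator measurableSet_Ioo,
        inter_eq_right.2 (Ioo_subset_Ioi_self : Ioo (0 : ℝ) 1 ⊆ Ioi 0)]
    rw [← h2, ← integral_const_mul, intervalIntegral.integral_of_le zero_le_one,
      integral_Ioc_eq_integral_Ioo, h3]
    refine setIntegral_congr_fun measurableSet_Ioi fun s hs => ?_
    have hs0 : (0 : ℝ) < s := hs
    by_cases hs1 : s < 1
    · have hm : s ^ p ∈ Ioo (0 : ℝ) 1 :=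
        ⟨by positivity, Real.rpow_lt_one hs0.le hs1 hp0⟩
      simp only [indicator_of_mem (show s ∈ Ioo (0 : ℝ) 1 from ⟨hs0, hs1⟩), indicator_of_mem hm,
        smul_eq_mul, sobolevWeight]
      have e1 : (s ^ 2) ^ (1 / (κ - 1)) = s ^ p := by
        rw [← Real.rpow_natCast, ← Real.rpow_mul hs0.le, hp]
        congr 1
        push_cast
        ring
      have e2 : s ^ (p - 1) * (s ^ p) ^ (κ - 1 - 1) = s := by
        rw [← Real.rpow_mul hs0.le, ← Real.rpow_add hs0]
        conv_rhs => rw [← Real.rpow_one s]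
        congr 1
        rw [hp]
        field_simp
        ring
      have e3 : (κ - 1) / 2 * p = 1 := by rw [hp]; field_simp
      rw [abs_of_pos hs0, e1]
      calc s * √(1 - s ^ p)
          = ((κ - 1) / 2 * p) * (s ^ (p - 1) * (s ^ p) ^ (κ - 1 - 1)) * √(1 - s ^ p) := by
            rw [e2, e3, one_mul]
        _ = _ := by ring
    · have hm : s ^ p ∉ Ioo (0 : ℝ) 1 := fun h =>
        absurd h.2 (not_lt.2 (Real.one_le_rpow (not_lt.1 hs1) hp0.le))
      simp [indicator_of_notMem hm, indicator_of_notMem (show s ∉ Ioo (0 : ℝ) 1 from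
        fun h => hs1 h.2)]
  have h2 : Real.Gamma (3 / 2) = √Real.pi / 2 := by
    rw [show (3 / 2 : ℝ) = 1 / 2 + 1 by norm_num, Real.Gamma_add_one (by norm_num),
      Real.Gamma_one_half_eq]
    ring
  have h3 : Real.Gamma κ = (κ - 1) * Real.Gamma (κ - 1) := by
    rw [← Real.Gamma_add_one h0.ne']; congr 1; ring
  have h4 := Real.Gamma_mul_Gamma_add_half κ
  have g0 : 0 < Real.Gamma κ := Real.Gamma_pos_of_pos (by linarith)
  have g1 : 0 < Real.Gamma (κ + 1 / 2) := Real.Gamma_pos_of_pos (by linarith)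
  have g2 : 0 < Real.Gamma (2 * κ) := Real.Gamma_pos_of_pos (by linarith)
  have h5 : (2 : ℝ) ^ (2 * κ - 1) * 2 ^ (1 - 2 * κ) = 1 := by
    rw [← Real.rpow_add two_pos]; simp
  rw [h1, integral_rpow_mul_sqrt h0, show κ - 1 + 3 / 2 = κ + 1 / 2 by ring, h2]
  rw [show 4 * ((κ - 1) / 2 * (Real.Gamma (κ - 1) * (√Real.pi / 2) / Real.Gamma (κ + 1 / 2)))
    = (κ - 1) * Real.Gamma (κ - 1) * √Real.pi / Real.Gamma (κ + 1 / 2) by ring, ← h3,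
    div_eq_div_iff g1.ne' g2.ne']
  calc Real.Gamma κ * √Real.pi * Real.Gamma (2 * κ)
      = Real.Gamma κ * (2 ^ (2 * κ - 1) * 2 ^ (1 - 2 * κ)) * √Real.pi * Real.Gamma (2 * κ) := by
        rw [h5, mul_one]
    _ = Real.Gamma κ * 2 ^ (2 * κ - 1) * (Real.Gamma (2 * κ) * 2 ^ (1 - 2 * κ) * √Real.pi) := by
        ring
    _ = _ := by rw [← h4]; ring

/-- A function with boundary values `0` that attains its maximal modulus `1` satisfies a sharp
lower bound for the energy `∫ r w'² + m² w² / r - r q w²`. -/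
theorem energy_lower_bound {κ m x y t : ℝ} (hκ : 1 < κ) (hm : 0 < m) (hx : 0 < x)
    (ht : t ∈ Icc x y) {w w' q : ℝ → ℝ} (hw : ∀ r ∈ Icc x y, HasDerivAt w (w' r) r)
    (hw' : ContinuousOn w' (Icc x y)) (hwx : w x = 0) (hwy : w y = 0) (hwt : w t = 1)
    (hw1 : ∀ r ∈ Icc x y, |w r| ≤ 1) (hq : ContinuousOn q (Icc x y))
    (hq0 : ∀ r ∈ Icc x y, 0 ≤ q r) :
    4 * m * (∫ s in (0 : ℝ)..1, sobolevWeight κ s)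
      - (κ - 1) ^ (κ - 1) / κ ^ κ * (m ^ 2) ^ (1 - κ) * ∫ r in x..y, r ^ (2 * κ - 1) * q r ^ κ
      ≤ ∫ r in x..y, (r * w' r ^ 2 + m ^ 2 * w r ^ 2 / r - r * q r * w r ^ 2) := by
  have hxy : x ≤ y := ht.1.trans ht.2
  have hpos : ∀ r ∈ Icc x y, 0 < r := fun r hr => hx.trans_le hr.1
  have hκ0 : 0 < κ := by linarith
  have hwc : ContinuousOn w (Icc x y) := fun r hr => (hw r hr).continuousAt.continuousWithinAt
  set W : ℝ → ℝ := sobolevWeight κ with hW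
  have hWc : Continuous W := continuous_sobolevWeight hκ
  have hcW : ContinuousOn (fun r => W (w r)) (Icc x y) := hWc.comp_continuousOn hwc
  set c : ℝ := (κ - 1) ^ (κ - 1) / κ ^ κ * (m ^ 2) ^ (1 - κ) with hc
  have hid : ContinuousOn (fun r : ℝ => r) (Icc x y) := continuousOn_id
  have hne : ∀ r ∈ Icc x y, r ≠ 0 := fun r hr => (hpos r hr).ne'
  have hpot : ContinuousOn (fun r => r ^ (2 * κ - 1) * q r ^ κ) (Icc x y) :=
    (hid.rpow_const fun r hr => Or.inl (hne r hr)).mul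
      (hq.rpow_const fun r _ => Or.inr hκ0.le)
  have hen : ContinuousOn (fun r => r * w' r ^ 2 + m ^ 2 * w r ^ 2 / r - r * q r * w r ^ 2)
      (Icc x y) :=
    ((hid.mul (hw'.pow 2)).add ((continuousOn_const.mul (hwc.pow 2)).div hid hne)).sub
      ((hid.mul hq).mul (hwc.pow 2))
  have habs : ContinuousOn (fun r => 2 * m * (|w' r| * W (w r))) (Icc x y) :=
    continuousOn_const.mul (hw'.abs.mul hcW)
  have hpt : ∀ r ∈ Icc x y, 2 * m * (|w' r| * W (w r)) - c * (r ^ (2 * κ - 1) * q r ^ κ)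
      ≤ r * w' r ^ 2 + m ^ 2 * w r ^ 2 / r - r * q r * w r ^ 2 := by
    intro r hr
    have hr0 := hpos r hr
    -- With t = m², x = w² and U = r² q, the power of w combines with m² w² to m² W(w)², and the
    -- rest depends on q alone.
    have h1 := mul_le_rpow_add_rpow hκ (show 0 < m ^ 2 by positivity) (sq_nonneg (w r))
      (show 0 ≤ r ^ 2 * q r from mul_nonneg (sq_nonneg r) (hq0 r hr))
    have h2 := sobolevWeight_sq hκ (hw1 r hr)
    have h3 : (r ^ 2 * q r) ^ κ = r * (r ^ (2 * κ - 1) * q r ^ κ) := by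
      rw [Real.mul_rpow (sq_nonneg r) (hq0 r hr), ← Real.rpow_natCast, ← Real.rpow_mul hr0.le,
        Real.rpow_sub_one hr0.ne']
      push_cast
      field_simp
    rw [← hc, h3] at h1
    -- Completing the square, after multiplication by r, leaves 2m |w'| W(w), which is bounded below
    -- by the derivative of a function of w up to sign.
    have h4 : 0 ≤ (r * |w' r| - m * W (w r)) ^ 2 := sq_nonneg _
    have h5 : (r * |w' r| - m * W (w r)) ^ 2
        = r ^ 2 * w' r ^ 2 - r * (2 * m * (|w' r| * W (w r)))
          + m ^ 2 * (w r ^ 2 - (w r ^ 2) ^ (κ / (κ - 1))) := by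
      rw [← h2, sub_sq, mul_pow, sq_abs]; ring
    have h6 : r * (r * w' r ^ 2 + m ^ 2 * w r ^ 2 / r - r * q r * w r ^ 2)
        = r ^ 2 * w' r ^ 2 + m ^ 2 * w r ^ 2 - w r ^ 2 * (r ^ 2 * q r) := by
      field_simp
    refine le_of_mul_le_mul_left ?_ hr0
    rw [h6]
    linarith
  have hii : ∀ {a b : ℝ} {g : ℝ → ℝ}, a ∈ Icc x y → b ∈ Icc x y → ContinuousOn g (Icc x y) →
      IntervalIntegrable g volume a b := fun ha hb hg =>
    (hg.mono (uIcc_subset_Icc ha hb)).intervalIntegrable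
  have mx : x ∈ Icc x y := left_mem_Icc.2 hxy
  have my : y ∈ Icc x y := right_mem_Icc.2 hxy
  have hsub : ∀ a ∈ Icc x y, ∀ b ∈ Icc x y,
      ∫ r in a..b, W (w r) * w' r = ∫ s in w a..w b, W s := fun a ha b hb =>
    intervalIntegral.integral_comp_mul_deriv (f := w) (f' := w') (g := W)
      (fun r hr => hw r (uIcc_subset_Icc ha hb hr))
      (hw'.mono (uIcc_subset_Icc ha hb)) hWc
  have hWw' : ContinuousOn (fun r => W (w r) * w' r) (Icc x y) := hcW.mul hw'
  -- Since |w'| ≥ w', only the endpoint values 0 and 1 of w matter; w need not be monotone. On [t,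
  -- y] the same argument uses |w'| ≥ -w'.
  have hl : m * 2 * ∫ s in (0 : ℝ)..1, W s ≤ ∫ r in x..t, 2 * m * (|w' r| * W (w r)) := by
    have h := hsub x mx t ht
    rw [hwx, hwt] at h
    rw [← h, ← intervalIntegral.integral_const_mul]
    refine intervalIntegral.integral_mono_on ht.1 (hii mx ht (continuousOn_const.mul hWw'))
      (hii mx ht habs) fun r _ => ?_
    have := mul_le_mul_of_nonneg_left (le_abs_self (w' r))
      (mul_nonneg (mul_nonneg hm.le zero_le_two) (sobolevWeight_nonneg κ (w r)))
    linarith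
  have hr : m * 2 * ∫ s in (0 : ℝ)..1, W s ≤ ∫ r in t..y, 2 * m * (|w' r| * W (w r)) := by
    have h := hsub t ht y my
    rw [hwy, hwt, intervalIntegral.integral_symm 0 1] at h
    rw [show m * 2 * ∫ s in (0 : ℝ)..1, W s = (-(m * 2)) * -∫ s in (0 : ℝ)..1, W s by ring, ← h,
      ← intervalIntegral.integral_const_mul]
    refine intervalIntegral.integral_mono_on ht.2 (hii ht my (continuousOn_const.mul hWw'))
      (hii ht my habs) fun r _ => ?_
    have := mul_le_mul_of_nonneg_left (neg_abs_le (w' r))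
      (mul_nonneg (mul_nonneg hm.le zero_le_two) (sobolevWeight_nonneg κ (w r)))
    linarith
  have hadd := intervalIntegral.integral_add_adjacent_intervals (hii mx ht habs) (hii ht my habs)
  have hmono := intervalIntegral.integral_mono_on hxy
    ((hii mx my habs).sub ((hii mx my hpot).const_mul c)) (hii mx my hen) hpt
  rw [intervalIntegral.integral_sub (hii mx my habs) ((hii mx my hpot).const_mul c),
    intervalIntegral.integral_const_mul c] at hmono
  linarith

/-- The constant in the bound for the number of negative eigenvalues. -/
def boundConst (α κ : ℝ) : ℝ :=
  (κ - 1) ^ (κ - 1) * Real.Gamma (2 * κ) / ((4 * α + 1) ^ (κ - 1 / 2) * κ ^ κ * Real.Gamma κ ^ 2)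

theorem boundConst_pos {α κ : ℝ} (hα : -(1 / 4) < α) (hκ : 1 < κ) : 0 < boundConst α κ := by
  have h0 : 0 < κ - 1 := by linarith
  have h1 : 0 < 4 * α + 1 := by linarith
  have g0 : 0 < Real.Gamma κ := Real.Gamma_pos_of_pos (by linarith)
  have g2 : 0 < Real.Gamma (2 * κ) := Real.Gamma_pos_of_pos (by linarith)
  unfold boundConst
  positivity

/-- The constant is the ratio of Young's coefficient to the lower bound 4m ∫₀¹ W, with m = √(α +
1/4). Its powers of 2 are absorbed by 4α + 1 = 4m². -/
theorem boundConst_mul_integral {α κ : ℝ} (hα : -(1 / 4) < α) (hκ : 1 < κ) :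
    boundConst α κ * (4 * √(α + 1 / 4) * ∫ s in (0 : ℝ)..1, sobolevWeight κ s)
      = (κ - 1) ^ (κ - 1) / κ ^ κ * (√(α + 1 / 4) ^ 2) ^ (1 - κ) := by
  have h1 : 0 < α + 1 / 4 := by linarith
  have g0 : 0 < Real.Gamma κ := Real.Gamma_pos_of_pos (by linarith)
  have g2 : 0 < Real.Gamma (2 * κ) := Real.Gamma_pos_of_pos (by linarith)
  have e1 : (4 * α + 1) ^ (κ - 1 / 2) = 2 ^ (2 * κ - 1) * (α + 1 / 4) ^ (κ - 1 / 2) := by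
    rw [show 4 * α + 1 = 2 ^ (2 : ℝ) * (α + 1 / 4) by norm_num; ring,
      Real.mul_rpow (by positivity) h1.le, ← Real.rpow_mul two_pos.le]
    congr 2
    ring
  have e2 : (α + 1 / 4) ^ (κ - 1 / 2) * (α + 1 / 4) ^ (1 - κ) = (α + 1 / 4) ^ (1 / 2 : ℝ) := by
    rw [← Real.rpow_add h1]; congr 1; ring
  rw [mul_right_comm 4, integral_sobolevWeight hκ, Real.sq_sqrt h1.le, boundConst, e1,
    Real.sqrt_eq_rpow, ← e2]
  have h2 : 0 < (α + 1 / 4) ^ (κ - 1 / 2) := Real.rpow_pos_of_pos h1 _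
  have h3 : (0 : ℝ) < 2 ^ (2 * κ - 1) := by positivity
  have h4 : 0 < κ ^ κ := Real.rpow_pos_of_pos (by linarith) _
  generalize (α + 1 / 4) ^ (κ - 1 / 2) = B at *
  generalize (2 : ℝ) ^ (2 * κ - 1) = D at *
  field_simp

/-- If the potential well `q` is so shallow that `boundConst α κ * ∫ r ^ (2κ - 1) q ^ κ ≤ 1` on
`[x, y]`, then the form of `-d²/dr² + α / r² - q` with Dirichlet conditions is nonnegative. -/
theorem dirichlet_form_nonneg {α κ x y : ℝ} (hα : -(1 / 4) < α) (hκ : 1 < κ) (hx : 0 < x)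
    (hxy : x ≤ y) {f f' q : ℝ → ℝ} (hf : ∀ r ∈ Icc x y, HasDerivAt f (f' r) r)
    (hf' : ContinuousOn f' (Icc x y)) (hfx : f x = 0) (hfy : f y = 0)
    (hq : ContinuousOn q (Icc x y)) (hq0 : ∀ r ∈ Icc x y, 0 ≤ q r)
    (hI : boundConst α κ * ∫ r in x..y, r ^ (2 * κ - 1) * q r ^ κ ≤ 1) :
    0 ≤ ∫ r in x..y, (f' r ^ 2 + α / r ^ 2 * f r ^ 2 - q r * f r ^ 2) := by
  have hpos : ∀ r ∈ Icc x y, 0 < r := fun r hr => hx.trans_le hr.1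
  have h1 : 0 < α + 1 / 4 := by linarith
  set m : ℝ := √(α + 1 / 4) with hm
  have hm0 : 0 < m := Real.sqrt_pos.2 h1
  have hm2 : m ^ 2 = α + 1 / 4 := Real.sq_sqrt h1.le
  have hfc : ContinuousOn f (Icc x y) := fun r hr => (hf r hr).continuousAt.continuousWithinAt
  -- The substitution f = √r w produces w²/(4r), which raises α to m² = α + 1/4, and the cross term
  -- w w', whose integral vanishes by the boundary values.
  set w : ℝ → ℝ := fun r => f r / √r with hw
  set w' : ℝ → ℝ := fun r => (f' r * √r - f r * (1 / (2 * √r))) / √r ^ 2 with hw'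
  have hwd : ∀ r ∈ Icc x y, HasDerivAt w (w' r) r := fun r hr =>
    (hf r hr).div (Real.hasDerivAt_sqrt (hpos r hr).ne') (Real.sqrt_pos.2 (hpos r hr)).ne'
  have hs : ContinuousOn (fun r : ℝ => √r) (Icc x y) := Real.continuous_sqrt.continuousOn
  have hsne : ∀ r ∈ Icc x y, √r ≠ 0 := fun r hr => (Real.sqrt_pos.2 (hpos r hr)).ne'
  have hw'c : ContinuousOn w' (Icc x y) :=
    ((hf'.mul hs).sub (hfc.mul (continuousOn_const.div (continuousOn_const.mul hs)
      fun r hr => mul_ne_zero two_ne_zero (hsne r hr)))).div (hs.pow 2)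
      fun r hr => pow_ne_zero 2 (hsne r hr)
  have hwc : ContinuousOn w (Icc x y) := fun r hr => (hwd r hr).continuousAt.continuousWithinAt
  have hid : ContinuousOn (fun r : ℝ => r) (Icc x y) := continuousOn_id
  have hen : ContinuousOn (fun r => r * w' r ^ 2 + m ^ 2 * w r ^ 2 / r - r * q r * w r ^ 2)
      (Icc x y) :=
    ((hid.mul (hw'c.pow 2)).add ((continuousOn_const.mul (hwc.pow 2)).div hid
      fun r hr => (hpos r hr).ne')).sub ((hid.mul hq).mul (hwc.pow 2))
  have hww : ContinuousOn (fun r => w r * w' r) (Icc x y) := hwc.mul hw'c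
  have hii : ∀ {g : ℝ → ℝ}, ContinuousOn g (Icc x y) → IntervalIntegrable g volume x y :=
    fun hg => hg.intervalIntegrable_of_Icc hxy
  have e1 : ∫ r in x..y, (f' r ^ 2 + α / r ^ 2 * f r ^ 2 - q r * f r ^ 2)
      = ∫ r in x..y, (r * w' r ^ 2 + m ^ 2 * w r ^ 2 / r - r * q r * w r ^ 2) := by
    have e2 : ∀ r ∈ uIcc x y, f' r ^ 2 + α / r ^ 2 * f r ^ 2 - q r * f r ^ 2
        = (r * w' r ^ 2 + m ^ 2 * w r ^ 2 / r - r * q r * w r ^ 2) + w r * w' r := by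
      intro r hr
      rw [uIcc_of_le hxy] at hr
      have hr0 := hpos r hr
      have hs0 : 0 < √r := Real.sqrt_pos.2 hr0
      have hsr : √r ^ 2 = r := Real.sq_sqrt hr0.le
      simp only [hw, hw', hm2]
      generalize √r = s at *
      subst hsr
      field_simp
      ring
    have e3 : ∫ r in x..y, w r * w' r = 0 := by
      have h := intervalIntegral.integral_comp_mul_deriv (f := w) (f' := w') (g := fun s => s)
        (fun r hr => hwd r (by rwa [uIcc_of_le hxy] at hr)) (by rwa [uIcc_of_le hxy])
        continuous_id
      have h0 : w x = 0 := by simp [hw, hfx]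
      have h0' : w y = 0 := by simp [hw, hfy]
      rw [h0, h0', intervalIntegral.integral_same] at h
      exact h
    rw [intervalIntegral.integral_congr e2, intervalIntegral.integral_add (hii hen) (hii hww), e3,
      add_zero]
  -- Dividing w by its value at a maximum of |w| gives the normalization of `energy_lower_bound`,
  -- also when that value is negative. If the value is 0, then w vanishes on [x, y].
  obtain ⟨t, ht, hmax⟩ := isCompact_Icc.exists_isMaxOn (nonempty_Icc.2 hxy) hwc.abs
  rw [e1]
  by_cases hwt : w t = 0
  · refine intervalIntegral.integral_nonneg hxy fun r hr => ?_
    have hr0 := hpos r hr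
    have h0 : w r = 0 := by
      have h : |w r| ≤ |w t| := hmax hr
      rw [hwt, abs_zero] at h
      exact abs_nonpos_iff.1 h
    rw [h0]
    have : 0 ≤ r * w' r ^ 2 := by positivity
    simpa using this
  · have hle := energy_lower_bound (w := fun r => w r / w t) (w' := fun r => w' r / w t) hκ hm0 hx
      ht (fun r hr => (hwd r hr).div_const _) (hw'c.div_const _)
      (by simp [hw, hfx]) (by simp [hw, hfy]) (div_self hwt)
      (fun r hr => by
        rw [abs_div]; exact div_le_one_of_le₀ (hmax hr) (abs_nonneg _)) hq hq0
    have hC := boundConst_mul_integral hα hκ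
    rw [← hm] at hC
    rw [← hC] at hle
    have hJ : 0 ≤ ∫ s in (0 : ℝ)..1, sobolevWeight κ s :=
      intervalIntegral.integral_nonneg zero_le_one fun s _ => sobolevWeight_nonneg κ s
    have h0 : 0 ≤ ∫ r in x..y, (r * (w' r / w t) ^ 2 + m ^ 2 * (w r / w t) ^ 2 / r
        - r * q r * (w r / w t) ^ 2) := by
      refine le_trans ?_ hle
      have := mul_le_mul_of_nonneg_left hI
        (show 0 ≤ 4 * m * ∫ s in (0 : ℝ)..1, sobolevWeight κ s by positivity)
      linarith
    have e4 : ∫ r in x..y, (r * w' r ^ 2 + m ^ 2 * w r ^ 2 / r - r * q r * w r ^ 2)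
        = w t ^ 2 * ∫ r in x..y, (r * (w' r / w t) ^ 2 + m ^ 2 * (w r / w t) ^ 2 / r
        - r * q r * (w r / w t) ^ 2) := by
      rw [← intervalIntegral.integral_const_mul]
      congr 1
      funext r
      field_simp
    rw [e4]
    positivity

/-! ### Test functions with prescribed zeros -/

theorem continuous_expr_inner (a b : ℝ) {V : ℝ → ℝ} (hV : ContinuousOn V (Ici 0)) (φ : Test) :
    Continuous fun r => ⟪expr a b V φ r, φ r⟫_ℝ :=
  (expr_continuous a b hV φ).inner φ.continuous

/-- As φ vanishes at both ends, integration by parts turns -⟪φ'', φ⟫ into |φ'|² without boundary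
terms. The potential is real, so the real and imaginary parts of φ can be treated separately. -/
theorem integral_expr_inner_nonneg {a b α κ x y : ℝ} {V q : ℝ → ℝ} (hV : ContinuousOn V (Ici 0))
    (hα : -(1 / 4) < α) (hκ : 1 < κ) (hx : 0 < x) (hxy : x ≤ y) (φ : Test) (hφx : φ x = 0)
    (hφy : φ y = 0) (hq : ContinuousOn q (Icc x y)) (hq0 : ∀ r ∈ Icc x y, 0 ≤ q r)
    (hpot : ∀ r ∈ Icc x y, α / r ^ 2 - q r ≤ potential a b V r)
    (hI : boundConst α κ * ∫ r in x..y, r ^ (2 * κ - 1) * q r ^ κ ≤ 1) :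
    0 ≤ ∫ r in x..y, ⟪expr a b V φ r, φ r⟫_ℝ := by
  have c0 : Continuous φ := φ.continuous
  have c1 : Continuous (deriv φ) := (test_contDiff_deriv φ).continuous
  have c2 : Continuous (deriv (deriv φ)) := test_continuous_deriv2 φ
  have hre := dirichlet_form_nonneg (f := fun r => (φ r).re) (f' := fun r => (deriv φ r).re)
    hα hκ hx hxy
    (fun r _ => Complex.reCLM.hasFDerivAt.comp_hasDerivAt r (test_hasDerivAt φ r))
    (Complex.continuous_re.comp c1).continuousOn (by simp [hφx]) (by simp [hφy]) hq hq0 hI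
  have him := dirichlet_form_nonneg (f := fun r => (φ r).im) (f' := fun r => (deriv φ r).im)
    hα hκ hx hxy
    (fun r _ => Complex.imCLM.hasFDerivAt.comp_hasDerivAt r (test_hasDerivAt φ r))
    (Complex.continuous_im.comp c1).continuousOn (by simp [hφx]) (by simp [hφy]) hq hq0 hI
  have hparts : ∫ r in x..y, (⟪deriv φ r, deriv φ r⟫_ℝ + ⟪deriv (deriv φ) r, φ r⟫_ℝ) = 0 := by
    rw [intervalIntegral.integral_eq_sub_of_hasDerivAt
      (f := fun r => ⟪deriv φ r, φ r⟫_ℝ)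
      (fun r _ => (test_hasDerivAt_deriv φ r).inner ℝ (test_hasDerivAt φ r))
      (((c1.inner c1).add (c2.inner c0)).intervalIntegrable _ _)]
    simp [hφx, hφy]
  have hii : ∀ {g : ℝ → ℝ}, ContinuousOn g (Icc x y) → IntervalIntegrable g volume x y :=
    fun hg => hg.intervalIntegrable_of_Icc hxy
  have hα2 : ContinuousOn (fun r : ℝ => α / r ^ 2) (Icc x y) :=
    continuousOn_const.div (continuous_pow 2).continuousOn fun r hr =>
      pow_ne_zero 2 (hx.trans_le hr.1).ne'
  have hform : ∀ {f f' : ℝ → ℝ}, Continuous f → Continuous f' →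
      IntervalIntegrable (fun r => f' r ^ 2 + α / r ^ 2 * f r ^ 2 - q r * f r ^ 2) volume x y :=
    fun hf hf' => hii (((hf'.pow 2).continuousOn.add (hα2.mul (hf.pow 2).continuousOn)).sub
      (hq.mul (hf.pow 2).continuousOn))
  have ire := hform (Complex.continuous_re.comp c0) (Complex.continuous_re.comp c1)
  have iim := hform (Complex.continuous_im.comp c0) (Complex.continuous_im.comp c1)
  have cparts : Continuous fun r => ⟪deriv φ r, deriv φ r⟫_ℝ + ⟪deriv (deriv φ) r, φ r⟫_ℝ :=
    (c1.inner c1).add (c2.inner c0)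
  have iparts := cparts.intervalIntegrable (μ := volume) x y
  have hmono := intervalIntegral.integral_mono_on hxy ((ire.add iim).sub iparts)
    ((continuous_expr_inner a b hV φ).intervalIntegrable _ _) (fun r hr => by
      have h1 : ⟪expr a b V φ r, φ r⟫_ℝ
          = ⟪-deriv (deriv φ) r, φ r⟫_ℝ + potential a b V r * ‖φ r‖ ^ 2 := by
        have : (potential a b V r : ℂ) * φ r = potential a b V r • φ r := by simp
        rw [expr, this, inner_add_left, real_inner_smul_left, real_inner_self_eq_norm_sq]
      have h2 : ∀ z : ℂ, ‖z‖ ^ 2 = z.re ^ 2 + z.im ^ 2 := fun z => by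
        rw [Complex.sq_norm, Complex.normSq_apply]; ring
      have h3 := mul_le_mul_of_nonneg_right (hpot r hr) (sq_nonneg ‖φ r‖)
      rw [h1, inner_neg_left]
      simp only [Function.comp_apply, real_inner_self_eq_norm_sq]
      rw [h2 (φ r)] at h3 ⊢
      rw [h2 (deriv φ r)]
      linarith)
  rw [intervalIntegral.integral_sub (ire.add iim) iparts, intervalIntegral.integral_add ire iim,
    hparts] at hmono
  refine le_trans ?_ hmono
  simp only [Function.comp_apply]
  linarith

/-- An interval can be cut into `n` pieces that all carry at most the `n`-th part of a mass. -/
theorem exists_partition {x y K : ℝ} (hxy : x < y) {g : ℝ → ℝ} (hg : ContinuousOn g (Icc x y))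
    (hg0 : ∀ r ∈ Icc x y, 0 ≤ g r) {n : ℕ} (hn : 0 < n) (hK : ∫ r in x..y, g r < n * K) :
    ∃ t : ℕ → ℝ, t 0 = x ∧ t n = y ∧ (∀ j ≤ n, t j ∈ Icc x y) ∧ (∀ j < n, t j ≤ t (j + 1)) ∧
      ∀ j < n, ∫ r in t j..t (j + 1), g r ≤ K := by
  have hn0 : (0 : ℝ) < n := Nat.cast_pos.2 hn
  have hxy' : 0 < y - x := sub_pos.2 hxy
  -- The slack in the mass is spread as a constant density δ. The primitive G is then strictly
  -- increasing even where g vanishes, and it ends exactly at n K; the cuts are its levels j K.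
  set δ : ℝ := (n * K - ∫ r in x..y, g r) / (y - x) with hδ
  have hδ0 : 0 < δ := div_pos (sub_pos.2 hK) hxy'
  have mx : x ∈ Icc x y := left_mem_Icc.2 hxy.le
  have my : y ∈ Icc x y := right_mem_Icc.2 hxy.le
  have hii : ∀ {c d : ℝ}, c ∈ Icc x y → d ∈ Icc x y → IntervalIntegrable g volume c d :=
    fun hc hd => (hg.mono (uIcc_subset_Icc hc hd)).intervalIntegrable
  set G : ℝ → ℝ := fun r => (∫ s in x..r, g s) + δ * (r - x) with hG
  have hGd : ∀ c ∈ Icc x y, ∀ d ∈ Icc x y, G d - G c = (∫ s in c..d, g s) + δ * (d - c) := by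
    intro c hc d hd
    rw [← intervalIntegral.integral_interval_sub_left (hii mx hd) (hii mx hc)]
    simp only [hG]; ring
  have hint : ∀ c ∈ Icc x y, ∀ d ∈ Icc x y, c ≤ d → 0 ≤ ∫ s in c..d, g s :=
    fun c hc d hd hcd => intervalIntegral.integral_nonneg hcd fun r hr =>
      hg0 r ⟨hc.1.trans hr.1, hr.2.trans hd.2⟩
  have hlt : ∀ c ∈ Icc x y, ∀ d ∈ Icc x y, c < d → G c < G d := by
    intro c hc d hd hcd
    have h1 := hGd c hc d hd
    have h2 := hint c hc d hd hcd.le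
    have h3 : 0 < δ * (d - c) := mul_pos hδ0 (sub_pos.2 hcd)
    linarith
  have hGx : G x = 0 := by simp [hG]
  have hGy : G y = n * K := by
    simp only [hG, hδ]
    rw [div_mul_cancel₀ _ hxy'.ne']
    ring
  have hK0 : 0 < K := by
    have h1 := hlt x mx y my hxy
    rw [hGx, hGy] at h1
    exact pos_of_mul_pos_right h1 hn0.le
  have hGc : ContinuousOn G (Icc x y) := by
    refine ContinuousOn.add ?_ (by fun_prop)
    have := intervalIntegral.continuousOn_primitive_interval (μ := volume) (a := x) (b := y)
      (f := g) (by rw [uIcc_of_le hxy.le]; exact hg.integrableOn_Icc)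
    rwa [uIcc_of_le hxy.le] at this
  have hex : ∀ j : ℕ, ∃ r, j ≤ n → r ∈ Icc x y ∧ G r = j * K := by
    intro j
    by_cases hj : j ≤ n
    · have hjn : (j : ℝ) ≤ n := Nat.cast_le.2 hj
      obtain ⟨r, hr, hr'⟩ := intermediate_value_Icc hxy.le hGc
        (show (j : ℝ) * K ∈ Icc (G x) (G y) by
          rw [hGx, hGy]
          exact ⟨by positivity, mul_le_mul_of_nonneg_right hjn hK0.le⟩)
      exact ⟨r, fun _ => ⟨hr, hr'⟩⟩
    · exact ⟨0, fun h => absurd h hj⟩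
  choose t ht using hex
  have hle : ∀ j < n, t j ≤ t (j + 1) := by
    intro j hj
    by_contra! h
    have h1 := hlt _ (ht _ hj).1 _ (ht _ hj.le).1 h
    rw [(ht _ hj).2, (ht _ hj.le).2] at h1
    push_cast at h1
    linarith
  refine ⟨t, ?_, ?_, fun j hj => (ht j hj).1, hle, fun j hj => ?_⟩
  · by_contra h
    have h0 := ht 0 hn.le
    have := hlt x mx _ h0.1 (lt_of_le_of_ne h0.1.1 (Ne.symm h))
    rw [h0.2, hGx] at this
    simp at this
  · by_contra h
    have h0 := ht n le_rfl
    have := hlt _ h0.1 y my (lt_of_le_of_ne h0.1.2 h)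
    rw [h0.2, hGy] at this
    exact lt_irrefl _ this
  · have h1 := hGd _ (ht _ hj.le).1 _ (ht _ hj).1
    rw [(ht _ hj.le).2, (ht _ hj).2] at h1
    have h2 : 0 ≤ δ * (t (j + 1) - t j) := mul_nonneg hδ0.le (sub_nonneg.2 (hle j hj))
    push_cast at h1
    linarith

theorem exists_Ioo_of_isCompact {K : Set ℝ} (hK : IsCompact K) (hK0 : K ⊆ Ioi 0) :
    ∃ x y : ℝ, 0 < x ∧ x < y ∧ K ⊆ Ioo x y := by
  rcases K.eq_empty_or_nonempty with rfl | hne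
  · exact ⟨1, 2, one_pos, one_lt_two, empty_subset _⟩
  · obtain ⟨x, hx⟩ := hK.exists_isLeast hne
    obtain ⟨y, hy⟩ := hK.exists_isGreatest hne
    have hx0 : 0 < x := hK0 hx.1
    have hxy : x ≤ y := hx.2 hy.1
    refine ⟨x / 2, y + 1, by linarith, by linarith, fun r hr => ⟨?_, ?_⟩⟩
    · linarith [hx.2 hr]
    · linarith [hy.2 hr]

/-- Evaluation of test functions at a point. -/
def testEval (r : ℝ) : Test →ₗ[ℂ] ℂ where
  toFun φ := φ r
  map_add' _ _ := rfl
  map_smul' _ _ := rfl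

/-- If the form of the operator is negative on an `n`-dimensional space of test functions, then `n`
is at most the weighted integral of the negative part of the potential. -/
theorem card_le_of_form_neg {a b α κ : ℝ} {V q : ℝ → ℝ} (hV : ContinuousOn V (Ici 0))
    (hα : -(1 / 4) < α) (hκ : 1 < κ) (hq : ContinuousOn q (Ioi 0)) (hq0 : ∀ r, 0 < r → 0 ≤ q r)
    (hpot : ∀ r, 0 < r → α / r ^ 2 - q r ≤ potential a b V r) {n : ℕ} (v : Fin n → Test)
    (hv : ∀ c : Fin n → ℂ, c ≠ 0 →
      ∫ r in Ioi (0 : ℝ), ⟪expr a b V (∑ i, c i • v i : Test) r, (∑ i, c i • v i : Test) r⟫_ℝ < 0) :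
    (n : ℝ≥0∞) ≤ ENNReal.ofReal (boundConst α κ) *
      ∫⁻ r in Ioi (0 : ℝ), ENNReal.ofReal (r ^ (2 * κ - 1) * q r ^ κ) := by
  -- From here on the dimension is n + 1, so there are n + 1 pieces but only n interior cuts.
  rcases n with _ | n
  · simp
  have hC := boundConst_pos hα hκ
  by_contra! hlt
  -- All supports lie in the open interval (x, y), so every combination vanishes at x and y as well.
  obtain ⟨x, y, hx, hxy, hsupp⟩ := exists_Ioo_of_isCompact
    (isCompact_iUnion fun i => (v i).hasCompactSupport)
    (iUnion_subset fun i => (v i).tsupport_subset)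
  have hIcc : Icc x y ⊆ Ioi 0 := fun r hr => hx.trans_le hr.1
  have hqI : ContinuousOn q (Icc x y) := hq.mono hIcc
  have hg : ContinuousOn (fun r => r ^ (2 * κ - 1) * q r ^ κ) (Icc x y) :=
    (continuousOn_id.rpow_const fun r hr => Or.inl (hIcc hr).ne').mul
      (hqI.rpow_const fun r _ => Or.inr (by linarith))
  have hg0 : ∀ r ∈ Icc x y, 0 ≤ r ^ (2 * κ - 1) * q r ^ κ := fun r hr => by
    have h1 : 0 < r := hIcc hr
    have h2 := hq0 r h1
    positivity
  have hmass : ∫ r in x..y, r ^ (2 * κ - 1) * q r ^ κ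
      < ((n + 1 : ℕ) : ℝ) * (1 / boundConst α κ) := by
    have h1 : ENNReal.ofReal (∫ r in x..y, r ^ (2 * κ - 1) * q r ^ κ)
        ≤ ∫⁻ r in Ioi (0 : ℝ), ENNReal.ofReal (r ^ (2 * κ - 1) * q r ^ κ) := by
      rw [intervalIntegral.integral_of_le hxy.le, ofReal_integral_eq_lintegral_ofReal
        (hg.integrableOn_Icc.mono_set Ioc_subset_Icc_self)
        ((ae_restrict_mem measurableSet_Ioc).mono fun r hr => hg0 r (Ioc_subset_Icc_self hr))]
      exact lintegral_mono_set (Ioc_subset_Icc_self.trans hIcc)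
    have h2 := (mul_le_mul_right h1 (ENNReal.ofReal (boundConst α κ))).trans_lt hlt
    rw [← ENNReal.ofReal_mul hC.le, ← ENNReal.ofReal_natCast,
      ENNReal.ofReal_lt_ofReal_iff (by positivity)] at h2
    rw [mul_one_div, lt_div_iff₀ hC, mul_comm]
    exact h2
  obtain ⟨t, ht0, htn, htI, htle, htK⟩ := exists_partition hxy hg hg0 n.succ_pos hmass
  set L : (Fin (n + 1) → ℂ) →ₗ[ℂ] (Fin n → ℂ) :=
    (LinearMap.pi fun j : Fin n => testEval (t (j + 1))).comp (Fintype.linearCombination ℂ v)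
    with hL
  -- Vanishing at the n interior cuts imposes n linear conditions on n + 1 coefficients.
  obtain ⟨c, hcL, hc⟩ := (Submodule.ne_bot_iff _).1
    (LinearMap.ker_ne_bot_of_finrank_lt (f := L) (by simp))
  refine absurd (hv c hc) (not_lt.2 ?_)
  set φ : Test := ∑ i, c i • v i with hφ
  have hφL : ∀ j < n, φ (t (j + 1)) = 0 := fun j hj => by
    have h := congrFun (LinearMap.mem_ker.1 hcL) ⟨j, hj⟩
    simpa [hL, Fintype.linearCombination_apply, testEval, hφ] using h
  have hoff : ∀ r ∉ Ioo x y, φ r = 0 := fun r hr => by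
    have h : testEval r φ = 0 := by
      rw [hφ, map_sum]
      refine Finset.sum_eq_zero fun i _ => ?_
      have h0 : testEval r (v i) = 0 := (test_zero_off (v i) fun h =>
        hr (hsupp (mem_iUnion.2 ⟨i, h⟩))).1
      rw [map_smul, h0, smul_zero]
    exact h
  have hz : ∀ j ≤ n + 1, φ (t j) = 0 := by
    intro j hj
    rcases j with _ | j
    · exact hoff _ (by rw [ht0]; exact fun h => lt_irrefl _ h.1)
    · rcases (Nat.succ_le_succ_iff.1 hj).lt_or_eq with h | rfl
      · exact hφL j h
      · exact hoff _ (by rw [htn]; exact fun h => lt_irrefl _ h.2)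
  have hcont := continuous_expr_inner a b hV φ
  have e1 : ∫ r in Ioi (0 : ℝ), ⟪expr a b V φ r, φ r⟫_ℝ
      = ∫ r in x..y, ⟪expr a b V φ r, φ r⟫_ℝ := by
    rw [intervalIntegral.integral_of_le hxy.le]
    refine setIntegral_eq_of_subset_of_forall_sdiff_eq_zero measurableSet_Ioi
      (Ioc_subset_Icc_self.trans hIcc) fun r hr => ?_
    rw [hoff r fun h => hr.2 (Ioo_subset_Ioc_self h), inner_zero_right]
  rw [e1, ← ht0, ← htn, ← intervalIntegral.sum_integral_adjacent_intervals
    fun j _ => hcont.intervalIntegrable _ _]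
  refine Finset.sum_nonneg fun j hj => ?_
  have hj' : j < n + 1 := Finset.mem_range.1 hj
  have hsub : Icc (t j) (t (j + 1)) ⊆ Icc x y :=
    Icc_subset_Icc (htI j hj'.le).1 (htI (j + 1) hj').2
  refine integral_expr_inner_nonneg hV hα hκ (hx.trans_le (htI j hj'.le).1) (htle j hj') φ
    (hz j hj'.le) (hz (j + 1) hj') (hqI.mono hsub) (fun r hr => hq0 r (hIcc (hsub hr)))
    (fun r hr => hpot r (hIcc (hsub hr))) ?_
  have h := mul_le_mul_of_nonneg_left (htK j hj') hC.le
  rwa [mul_one_div_cancel hC.ne'] at h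

/-! ### Negative eigenvalues and the quadratic form -/

section Abstract

variable {H : Type*} [NormedAddCommGroup H] [InnerProductSpace ℂ H]

/-- The positive semidefinite form `⟪T x, y⟫ + c ⟪x, y⟫` of a symmetric operator that is bounded
from below by `-c`. -/
abbrev shiftedFormCore {T : H →ₗ.[ℂ] H} (hsym : T.IsFormalAdjoint T) {c : ℝ}
    (hc : ∀ x : T.domain, -c * ‖(x : H)‖ ^ 2 ≤ (⟪T x, (x : H)⟫_ℂ).re) :
    PreInnerProductSpace.Core ℂ T.domain where
  inner x y := ⟪T x, (y : H)⟫_ℂ + c * ⟪(x : H), (y : H)⟫_ℂ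
  conj_inner_symm x y := by
    simp only [map_add, map_mul, inner_conj_symm, Complex.conj_ofReal]
    rw [hsym x y]
  re_inner_nonneg x := by
    have h := hc x
    have h2 : ⟪(x : H), (x : H)⟫_ℂ = ((‖(x : H)‖ ^ 2 : ℝ) : ℂ) := by
      rw [inner_self_eq_norm_sq_to_K]; norm_cast
    change 0 ≤ (⟪T x, (x : H)⟫_ℂ + c * ⟪(x : H), (x : H)⟫_ℂ).re
    rw [h2, Complex.add_re, Complex.re_ofReal_mul, Complex.ofReal_re]
    linarith
  add_left x y z := by
    simp only [LinearPMap.map_add, Submodule.coe_add, inner_add_left]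
    ring
  smul_left x y r := by
    simp only [LinearPMap.map_smul, Submodule.coe_smul, inner_smul_left]
    ring

/-- This is the Cauchy–Schwarz inequality for the form of T shifted by c, which is positive
semidefinite. It lets form-Cauchy sequences be handled like Cauchy sequences for a seminorm. -/
theorem norm_shiftedForm_sq_le {T : H →ₗ.[ℂ] H} (hsym : T.IsFormalAdjoint T) {c : ℝ}
    (hc : ∀ x : T.domain, -c * ‖(x : H)‖ ^ 2 ≤ (⟪T x, (x : H)⟫_ℂ).re) (x y : T.domain) :
    ‖⟪T x, (y : H)⟫_ℂ + c * ⟪(x : H), (y : H)⟫_ℂ‖ ^ 2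
      ≤ (quadForm T x + c * ‖(x : H)‖ ^ 2) * (quadForm T y + c * ‖(y : H)‖ ^ 2) := by
  have h := @InnerProductSpace.Core.inner_mul_inner_self_le ℂ T.domain _ _ _
    (shiftedFormCore hsym hc) x y
  have h2 : ∀ z : T.domain, (⟪T z, (z : H)⟫_ℂ + c * ⟪(z : H), (z : H)⟫_ℂ).re
      = quadForm T z + c * ‖(z : H)‖ ^ 2 := by
    intro z
    have h2 : ⟪(z : H), (z : H)⟫_ℂ = ((‖(z : H)‖ ^ 2 : ℝ) : ℂ) := by
      rw [inner_self_eq_norm_sq_to_K]; norm_cast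
    rw [h2, Complex.add_re, Complex.re_ofReal_mul, Complex.ofReal_re, quadForm]
  have h3 : ‖⟪T y, (x : H)⟫_ℂ + c * ⟪(y : H), (x : H)⟫_ℂ‖
      = ‖⟪T x, (y : H)⟫_ℂ + c * ⟪(x : H), (y : H)⟫_ℂ‖ := by
    rw [← Complex.norm_conj]
    simp only [map_add, map_mul, inner_conj_symm, Complex.conj_ofReal]
    rw [hsym x y]
  have h4 : ‖⟪T x, (y : H)⟫_ℂ + c * ⟪(x : H), (y : H)⟫_ℂ‖
      * ‖⟪T y, (x : H)⟫_ℂ + c * ⟪(y : H), (x : H)⟫_ℂ‖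
      ≤ (⟪T x, (x : H)⟫_ℂ + c * ⟪(x : H), (x : H)⟫_ℂ).re
        * (⟪T y, (y : H)⟫_ℂ + c * ⟪(y : H), (y : H)⟫_ℂ).re := h
  rw [h3, h2, h2] at h4
  rw [sq]
  exact h4

/-- Along sequences that are Cauchy for the form of `T`, the sesquilinear form of `T` converges. -/
theorem tendsto_inner_of_form_cauchy {T : H →ₗ.[ℂ] H} (hsym : T.IsFormalAdjoint T)
    (hT : SemiboundedBelow T) {φ ψ : ℕ → T.domain} {u v w : H}
    (hφ : Tendsto (fun n => (φ n : H)) atTop (𝓝 u))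
    (hφq : Tendsto (fun p : ℕ × ℕ => quadForm T (φ p.1 - φ p.2)) atTop (𝓝 0))
    (hψ : Tendsto (fun n => (ψ n : H)) atTop (𝓝 v))
    (hψq : Tendsto (fun p : ℕ × ℕ => quadForm T (ψ p.1 - ψ p.2)) atTop (𝓝 0))
    (hw : ∀ x : T.domain, ⟪T x, v⟫_ℂ = ⟪(x : H), w⟫_ℂ) :
    Tendsto (fun n => ⟪T (φ n), (ψ n : H)⟫_ℂ) atTop (𝓝 ⟪u, w⟫_ℂ) := by
  obtain ⟨c, hc⟩ := hT
  set N : T.domain → ℝ := fun x => quadForm T x + c * ‖(x : H)‖ ^ 2 with hN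
  have hN0 : ∀ x, 0 ≤ N x := fun x => by
    have := quadForm_ge hc x
    simp only [hN]; linarith
  have f1 : Tendsto (Prod.fst : ℕ × ℕ → ℕ) atTop atTop := by
    rw [← prod_atTop_atTop_eq]; exact tendsto_fst
  have f2 : Tendsto (Prod.snd : ℕ × ℕ → ℕ) atTop atTop := by
    rw [← prod_atTop_atTop_eq]; exact tendsto_snd
  have hNc : ∀ {χ : ℕ → T.domain} {z : H}, Tendsto (fun n => (χ n : H)) atTop (𝓝 z) →
      Tendsto (fun p : ℕ × ℕ => quadForm T (χ p.1 - χ p.2)) atTop (𝓝 0) →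
      Tendsto (fun p : ℕ × ℕ => N (χ p.1 - χ p.2)) atTop (𝓝 0) := by
    intro χ z h1 h2
    have h3 : Tendsto (fun p : ℕ × ℕ => (χ p.1 : H) - χ p.2) atTop (𝓝 0) := by
      simpa using (h1.comp f1).sub (h1.comp f2)
    simpa [hN] using h2.add ((h3.norm.pow 2).const_mul c)
  have hsmall : ∀ {χ : ℕ → T.domain}, Tendsto (fun p : ℕ × ℕ => N (χ p.1 - χ p.2)) atTop (𝓝 0) →
      ∀ ε > 0, ∃ K, ∀ n ≥ K, ∀ m ≥ K, N (χ n - χ m) < ε := by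
    intro χ h ε hε
    obtain ⟨⟨k, l⟩, hkl⟩ := eventually_atTop.1 (h.eventually_lt_const hε)
    exact ⟨max k l, fun n hn m hm => hkl (n, m)
      ⟨(le_max_left k l).trans hn, (le_max_right k l).trans hm⟩⟩
  have hNφ := hNc hφ hφq
  have hNψ := hNc hψ hψq
  obtain ⟨K₀, hK₀⟩ := hsmall hNφ 1 one_pos
  -- This bounds N(φ n) through N(x + y) ≤ 2 N(x) + 2 N(y), with x = φ n - φ K₀ of N-value below 1.
  set B : ℝ := 2 + 2 * N (φ K₀) with hB
  have hB0 : 0 ≤ B := by have := hN0 (φ K₀); positivity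
  have hbound : ∀ n ≥ K₀, N (φ n) ≤ B := by
    intro n hn
    have h1 := quadForm_add_le hc (φ n - φ K₀) (φ K₀)
    have h2 := parallelogram_law_with_norm ℂ ((φ n - φ K₀ : T.domain) : H) (φ K₀ : H)
    have h3 := hK₀ n hn K₀ le_rfl
    have h4 : ((φ n - φ K₀ : T.domain) : H) + (φ K₀ : H) = (φ n : H) := by simp
    rw [sub_add_cancel] at h1
    rw [h4] at h2
    simp only [hN, hB] at h3 ⊢
    linear_combination h1 + 2 * h3 + c * h2
  have hdiff : Tendsto (fun n => (⟪T (φ n), (ψ n : H)⟫_ℂ + c * ⟪(φ n : H), (ψ n : H)⟫_ℂ)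
      - (⟪(φ n : H), w⟫_ℂ + c * ⟪(φ n : H), v⟫_ℂ)) atTop (𝓝 0) := by
    rw [Metric.tendsto_atTop]
    intro ε hε
    obtain ⟨K, hK⟩ := hsmall hNψ ((ε / 2) ^ 2 / (B + 1)) (by positivity)
    refine ⟨max K K₀, fun n hn => ?_⟩
    have hnK : K ≤ n := (le_max_left _ _).trans hn
    -- For fixed n, ψ m converges in H, so T (φ n) can be paired with the limit v and moved to w by
    -- `hw`. Cauchy–Schwarz makes the error uniform in large n.
    have hlim : Tendsto (fun m => (⟪T (φ n), (ψ n : H)⟫_ℂ + c * ⟪(φ n : H), (ψ n : H)⟫_ℂ)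
        - (⟪T (φ n), (ψ m : H)⟫_ℂ + c * ⟪(φ n : H), (ψ m : H)⟫_ℂ)) atTop
        (𝓝 ((⟪T (φ n), (ψ n : H)⟫_ℂ + c * ⟪(φ n : H), (ψ n : H)⟫_ℂ)
        - (⟪(φ n : H), w⟫_ℂ + c * ⟪(φ n : H), v⟫_ℂ))) := by
      rw [← hw]
      exact ((tendsto_const_nhds.inner hψ).add
        ((tendsto_const_nhds.inner hψ).const_mul _)).const_sub _
    have hle : ‖(⟪T (φ n), (ψ n : H)⟫_ℂ + c * ⟪(φ n : H), (ψ n : H)⟫_ℂ)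
        - (⟪(φ n : H), w⟫_ℂ + c * ⟪(φ n : H), v⟫_ℂ)‖ ≤ ε / 2 := by
      refine le_of_tendsto hlim.norm (eventually_atTop.2 ⟨K, fun m hm => ?_⟩)
      have h1 := norm_shiftedForm_sq_le hsym hc (φ n) (ψ n - ψ m)
      have h2 : ⟪T (φ n), ((ψ n - ψ m : T.domain) : H)⟫_ℂ
          + c * ⟪(φ n : H), ((ψ n - ψ m : T.domain) : H)⟫_ℂ
          = (⟪T (φ n), (ψ n : H)⟫_ℂ + c * ⟪(φ n : H), (ψ n : H)⟫_ℂ)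
        - (⟪T (φ n), (ψ m : H)⟫_ℂ + c * ⟪(φ n : H), (ψ m : H)⟫_ℂ) := by
        simp only [Submodule.coe_sub, inner_sub_right]; ring
      rw [h2] at h1
      refine (sq_le_sq₀ (norm_nonneg _) (by positivity)).1 (h1.trans ?_)
      have h3 := hbound n ((le_max_right _ _).trans hn)
      have h4 := (hK n hnK m hm).le
      calc N (φ n) * N (ψ n - ψ m) ≤ B * ((ε / 2) ^ 2 / (B + 1)) :=
            mul_le_mul h3 h4 (hN0 _) hB0
        _ ≤ (ε / 2) ^ 2 := by
            rw [mul_div_assoc', div_le_iff₀ (by positivity)]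
            nlinarith [sq_nonneg (ε / 2)]
    rw [dist_zero_right]
    linarith
  have hrest : Tendsto (fun n => (⟪(φ n : H), w⟫_ℂ + c * ⟪(φ n : H), v⟫_ℂ)
      - c * ⟪(φ n : H), (ψ n : H)⟫_ℂ) atTop (𝓝 ((⟪u, w⟫_ℂ + c * ⟪u, v⟫_ℂ) - c * ⟪u, v⟫_ℂ)) :=
    ((hφ.inner tendsto_const_nhds).add ((hφ.inner tendsto_const_nhds).const_mul _)).sub
      ((hφ.inner hψ).const_mul _)
  have hsum := hdiff.add hrest
  rw [zero_add, add_sub_cancel_right] at hsum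
  refine hsum.congr fun n => ?_
  ring

/-- An extension of `T` by vectors of the form domain on which the adjoint acts is symmetric. -/
theorem isFormalAdjoint_self_of_isFormLimit {T S : H →ₗ.[ℂ] H} (hsym : T.IsFormalAdjoint T)
    (hT : SemiboundedBelow T) (hS : S.IsFormalAdjoint T)
    (hSl : ∀ x : S.domain, IsFormLimit T (x : H)) : S.IsFormalAdjoint S := by
  intro x y
  obtain ⟨φ, hφ, hφq⟩ := hSl x
  obtain ⟨ψ, hψ, hψq⟩ := hSl y
  have h1 := tendsto_inner_of_form_cauchy hsym hT hφ hφq hψ hψq (fun z => hS.symm z y)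
  have h2 := tendsto_inner_of_form_cauchy hsym hT hψ hψq hφ hφq (fun z => hS.symm z x)
  have h3 := (Complex.continuous_conj.tendsto _).comp h2
  rw [inner_conj_symm] at h3
  -- By the symmetry of T, both sides of the desired identity are limits of the same sequence.
  refine tendsto_nhds_unique h3 (h1.congr fun n => ?_)
  simp only [Function.comp_apply, inner_conj_symm]
  exact hsym (φ n) (ψ n)

theorem mem_eigenspace {S : H →ₗ.[ℂ] H} {z : ℂ} {x : H} :
    x ∈ eigenspace S z ↔ ∃ y : S.domain, (y : H) = x ∧ S y = z • (y : H) := by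
  simp only [eigenspace, Submodule.mem_map, LinearMap.mem_ker, LinearMap.sub_apply,
    LinearMap.smul_apply, Submodule.subtype_apply, sub_eq_zero]
  exact ⟨fun ⟨y, h1, h2⟩ => ⟨y, h2, h1⟩, fun ⟨y, h1, h2⟩ => ⟨y, h2, h1⟩⟩

theorem inner_eq_zero_of_mem_eigenspace {S : H →ₗ.[ℂ] H} (hS : S.IsFormalAdjoint S) {μ ν : ℝ}
    (hμν : μ ≠ ν) {x y : H} (hx : x ∈ eigenspace S μ) (hy : y ∈ eigenspace S ν) :
    ⟪x, y⟫_ℂ = 0 := by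
  obtain ⟨x, rfl, hSx⟩ := mem_eigenspace.1 hx
  obtain ⟨y, rfl, hSy⟩ := mem_eigenspace.1 hy
  have h := hS x y
  rw [hSx, hSy, inner_smul_left, inner_smul_right, Complex.conj_ofReal, ← sub_eq_zero,
    ← sub_mul] at h
  refine (mul_eq_zero.1 h).resolve_left fun h => hμν ?_
  exact_mod_cast sub_eq_zero.1 h

/-- Each subtracted projection comes either from the same eigenspace or from an orthogonal one, in
which case it is zero. -/
theorem gramSchmidt_mem_eigenspace {S : H →ₗ.[ℂ] H} (hS : S.IsFormalAdjoint S) {n : ℕ}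
    {v : Fin n → H} {μ : Fin n → ℝ} (hv : ∀ i, v i ∈ eigenspace S (μ i)) (i : Fin n) :
    InnerProductSpace.gramSchmidt ℂ v i ∈ eigenspace S (μ i) := by
  induction i using WellFoundedLT.induction with
  | ind i ih =>
    rw [InnerProductSpace.gramSchmidt_def]
    refine Submodule.sub_mem _ (hv i) (Submodule.sum_mem _ fun j hj => ?_)
    have hj' := ih j (Finset.mem_Iio.1 hj)
    rw [Submodule.starProjection_singleton]
    by_cases h : μ j = μ i
    · rw [h] at hj'
      exact Submodule.smul_mem _ _ hj'
    · rw [inner_eq_zero_of_mem_eigenspace hS h hj' (hv i)]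
      simp

/-- The span of all the eigenvectors has a basis consisting of eigenvectors. Any n of them can be
orthonormalized within their eigenspaces, as S is symmetric. -/
theorem exists_orthonormal_eigenvectors {S : H →ₗ.[ℂ] H} (hS : S.IsFormalAdjoint S) {n : ℕ}
    (hn : (n : ℕ∞) ≤ numNegEigenvalues S) :
    ∃ (u : Fin n → S.domain) (μ : Fin n → ℝ), (∀ i, μ i < 0) ∧
      (∀ i, S (u i) = (μ i : ℂ) • (u i : H)) ∧ Orthonormal ℂ fun i => (u i : H) := by
  rw [numNegEigenvalues, Submodule.iSup_eq_span] at hn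
  obtain ⟨b, hbs, hspan, hli⟩ := exists_linearIndependent ℂ
    (⋃ μ : Iio (0 : ℝ), (eigenspace S ((μ : ℝ) : ℂ) : Set H))
  rw [← hspan, rank_span_set hli, Cardinal.natCast_le_toENat] at hn
  have hemb : Nonempty (Fin n ↪ b) := by
    rw [← Cardinal.lift_mk_le']
    simpa using hn
  obtain ⟨e⟩ := hemb
  have hmem : ∀ i, ∃ μ : ℝ, μ < 0 ∧ (e i : H) ∈ eigenspace S (μ : ℂ) := by
    intro i
    obtain ⟨μ, hμ⟩ := mem_iUnion.1 (hbs (e i).2)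
    exact ⟨μ, μ.2, hμ⟩
  choose μ hμ hv using hmem
  have hli' : LinearIndependent ℂ fun i => (e i : H) := hli.comp e e.injective
  have hon := InnerProductSpace.gramSchmidtNormed_orthonormal hli'
  have hg : ∀ i, InnerProductSpace.gramSchmidtNormed ℂ (fun i => (e i : H)) i
      ∈ eigenspace S (μ i) := fun i =>
    Submodule.smul_mem _ _ (gramSchmidt_mem_eigenspace hS hv i)
  choose u hu hSu using fun i => mem_eigenspace.1 (hg i)
  refine ⟨u, μ, hμ, hSu, ?_⟩
  convert hon using 1
  exact funext hu

/-- Perturbation of a negative diagonal matrix. -/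
theorem re_sum_lt_zero_of_near_diagonal {n : ℕ} {δ η : ℝ} {μ : Fin n → ℝ} (hμ : ∀ i, μ i ≤ -δ)
    (hη : 0 ≤ η) (hηδ : η * n < δ) {G : Fin n → Fin n → ℂ}
    (hG : ∀ i j, ‖G i j - if i = j then (μ j : ℂ) else 0‖ ≤ η) {c : Fin n → ℂ} (hc : c ≠ 0) :
    (∑ i, ∑ j, (starRingEnd ℂ) (c i) * (c j * G i j)).re < 0 := by
  have hpos : 0 < ∑ i, ‖c i‖ ^ 2 := by
    obtain ⟨i, hi⟩ := Function.ne_iff.1 hc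
    refine Finset.sum_pos' (fun i _ => sq_nonneg _) ⟨i, Finset.mem_univ i, ?_⟩
    have : 0 < ‖c i‖ := norm_pos_iff.2 hi
    positivity
  have hdiag : (∑ i, ∑ j, (starRingEnd ℂ) (c i) * (c j * if i = j then (μ j : ℂ) else 0)).re
      = ∑ i, μ i * ‖c i‖ ^ 2 := by
    rw [Complex.re_sum]
    refine Finset.sum_congr rfl fun i _ => ?_
    simp only [mul_ite, mul_zero, Finset.sum_ite_eq, Finset.mem_univ, if_true]
    rw [← mul_assoc, Complex.conj_mul', ← Complex.ofReal_pow, ← Complex.ofReal_mul,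
      Complex.ofReal_re, mul_comm]
  have hdiag' : ∑ i, μ i * ‖c i‖ ^ 2 ≤ -δ * ∑ i, ‖c i‖ ^ 2 := by
    rw [Finset.mul_sum]
    exact Finset.sum_le_sum fun i _ => mul_le_mul_of_nonneg_right (hμ i) (sq_nonneg _)
  have hrest : (∑ i, ∑ j, (starRingEnd ℂ) (c i)
      * (c j * (G i j - if i = j then (μ j : ℂ) else 0))).re ≤ η * n * ∑ i, ‖c i‖ ^ 2 := by
    refine (Complex.re_le_norm _).trans ?_
    calc ‖∑ i, ∑ j, (starRingEnd ℂ) (c i) * (c j * (G i j - if i = j then (μ j : ℂ) else 0))‖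
        ≤ ∑ i, ∑ j, ‖c i‖ * (‖c j‖ * η) := by
          refine norm_sum_le_of_le _ fun i _ => norm_sum_le_of_le _ fun j _ => ?_
          rw [norm_mul, norm_mul, Complex.norm_conj]
          gcongr
          exact hG i j
      _ = η * (∑ i, ‖c i‖) ^ 2 := by
          rw [sq, Finset.sum_mul_sum, Finset.mul_sum]
          refine Finset.sum_congr rfl fun i _ => ?_
          rw [Finset.mul_sum]
          exact Finset.sum_congr rfl fun j _ => by ring
      _ ≤ η * (n * ∑ i, ‖c i‖ ^ 2) := by
          gcongr
          simpa using sq_sum_le_card_mul_sum_sq (s := Finset.univ) (f := fun i => ‖c i‖)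
      _ = _ := by ring
  have hsplit : ∑ i, ∑ j, (starRingEnd ℂ) (c i) * (c j * G i j)
      = ∑ i, ∑ j, (starRingEnd ℂ) (c i) * (c j * if i = j then (μ j : ℂ) else 0)
        + ∑ i, ∑ j, (starRingEnd ℂ) (c i)
      * (c j * (G i j - if i = j then (μ j : ℂ) else 0)) := by
    rw [← Finset.sum_add_distrib]
    refine Finset.sum_congr rfl fun i _ => ?_
    rw [← Finset.sum_add_distrib]
    exact Finset.sum_congr rfl fun j _ => by ring
  rw [hsplit, Complex.add_re, hdiag]
  have : (η * n - δ) * ∑ i, ‖c i‖ ^ 2 < 0 := mul_neg_of_neg_of_pos (by linarith) hpos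
  linarith

/-- If `S` has at least `n` negative eigenvalues, then the quadratic form of `T` is negative on an
`n`-dimensional subspace of the domain of `T`. -/
theorem exists_quadForm_neg {T S : H →ₗ.[ℂ] H} (hsym : T.IsFormalAdjoint T)
    (hT : SemiboundedBelow T) (hS : S.IsFormalAdjoint T)
    (hSl : ∀ x : S.domain, IsFormLimit T (x : H)) {n : ℕ}
    (hn : (n : ℕ∞) ≤ numNegEigenvalues S) :
    ∃ v : Fin n → T.domain, ∀ c : Fin n → ℂ, c ≠ 0 → quadForm T (∑ i, c i • v i) < 0 := by
  obtain ⟨u, μ, hμ, hSu, hon⟩ := exists_orthonormal_eigenvectors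
    (isFormalAdjoint_self_of_isFormLimit hsym hT hS hSl) hn
  choose φ hφ hφq using fun i => hSl (u i)
  -- Finitely many negative numbers have a common gap from 0; taking δ small instead of a minimum
  -- also covers n = 0.
  obtain ⟨δ, hδ, hμδ⟩ : ∃ δ > 0, ∀ i, μ i ≤ -δ := by
    have h : ∀ᶠ δ in 𝓝[>] (0 : ℝ), ∀ i, μ i ≤ -δ := by
      rw [eventually_all]
      intro i
      have h1 : Tendsto (fun δ : ℝ => -δ) (𝓝[>] 0) (𝓝 0) := by
        simpa using (continuous_neg.tendsto (0 : ℝ)).mono_left nhdsWithin_le_nhds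
      exact (h1.eventually_const_lt (hμ i)).mono fun _ h => h.le
    obtain ⟨δ, h1, h2⟩ := (h.and self_mem_nhdsWithin).exists
    exact ⟨δ, h2, h1⟩
  set η : ℝ := δ / (n + 1) with hη
  have hη0 : 0 < η := by positivity
  have hηδ : η * n < δ := by
    rw [hη, div_mul_eq_mul_div, div_lt_iff₀ (by positivity)]
    linarith
  have hlim : ∀ i j, Tendsto (fun k => ⟪T (φ i k), (φ j k : H)⟫_ℂ) atTop
      (𝓝 (if i = j then (μ j : ℂ) else 0)) := by
    intro i j
    have h := tendsto_inner_of_form_cauchy hsym hT (hφ i) (hφq i) (hφ j) (hφq j)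
      (fun z => hS.symm z (u j))
    rw [hSu, inner_smul_right, orthonormal_iff_ite.1 hon i j] at h
    simpa using h
  have hev : ∀ᶠ k in atTop, ∀ i j, ‖⟪T (φ i k), (φ j k : H)⟫_ℂ - if i = j then (μ j : ℂ) else 0‖
      ≤ η := by
    rw [eventually_all]
    intro i
    rw [eventually_all]
    intro j
    have h := (hlim i j).sub_const (if i = j then (μ j : ℂ) else 0)
    rw [sub_self] at h
    have h2 := h.norm
    rw [norm_zero] at h2
    exact (h2.eventually_lt_const hη0).mono fun _ h => h.le
  obtain ⟨k, hk⟩ := hev.exists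
  refine ⟨fun i => φ i k, fun c hc => ?_⟩
  have h := re_sum_lt_zero_of_near_diagonal hμδ hη0.le hηδ hk hc
  have e : quadForm T (∑ i, c i • φ i k)
      = (∑ i, ∑ j, (starRingEnd ℂ) (c i) * (c j * ⟪T (φ i k), (φ j k : H)⟫_ℂ)).re := by
    have h1 : T (∑ i, c i • φ i k) = ∑ i, c i • T (φ i k) := by
      change T.toFun _ = _
      rw [map_sum]
      exact Finset.sum_congr rfl fun i _ => T.toFun.map_smul _ _
    rw [quadForm, h1, sum_inner]
    simp only [Submodule.coe_sum, Submodule.coe_smul, inner_sum, inner_smul_left,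
      inner_smul_right, mul_left_comm]
  rw [e]
  exact h

end Abstract

/-! ### The minimal operator -/

/-- A function orthogonal to all test functions vanishes almost everywhere, by the fundamental lemma
of the calculus of variations; real test functions suffice. -/
theorem dense_range_testToL2 : Dense (LinearMap.range testToL2 : Set L2) := by
  rw [Submodule.dense_iff_topologicalClosure_eq_top, Submodule.topologicalClosure_eq_top_iff,
    Submodule.eq_bot_iff]
  intro f hf
  have hloc : LocallyIntegrable f (volume.restrict (Ioi (0 : ℝ))) :=
    (Lp.memLp f).locallyIntegrable one_le_two
  have hae := isOpen_Ioi.ae_eq_zero_of_integral_contDiff_smul_eq_zero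
    (hloc.locallyIntegrableOn (Ioi 0)) fun g hg hgc hgs => by
      let φ : Test :=
        { toFun := fun r => (g r : ℂ)
          contDiff' := Complex.ofRealCLM.contDiff.comp hg
          hasCompactSupport' := hgc.comp_left (g := fun x : ℝ => (x : ℂ)) Complex.ofReal_zero
          tsupport_subset' :=
            (closure_mono (Function.support_comp_subset Complex.ofReal_zero g)).trans hgs }
      have h := hf (testToL2 φ) (LinearMap.mem_range_self _ φ)
      rw [MeasureTheory.L2.inner_def] at h
      rw [← h]
      refine integral_congr_ae ?_
      have hφ : ⇑(testToL2 φ) =ᵐ[volume.restrict (Ioi (0 : ℝ))] φ := (memLp_test φ).coeFn_toLp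
      filter_upwards [hφ] with r hr
      have h2 : φ r = (g r : ℂ) := rfl
      rw [hr, h2, RCLike.inner_apply, Complex.conj_ofReal, mul_comm, Complex.real_smul]
  refine (Lp.eq_zero_iff_ae_eq_zero).2 ?_
  filter_upwards [hae, ae_restrict_mem measurableSet_Ioi] with r h1 h2 using h1 h2

theorem inner_exprToL2_testToL2 (a b : ℝ) {V : ℝ → ℝ} (hV : ContinuousOn V (Ici 0)) (φ ψ : Test) :
    ⟪exprToL2 a b V hV φ, testToL2 ψ⟫_ℂ = ∫ r in Ioi (0 : ℝ), ⟪expr a b V φ r, ψ r⟫_ℂ := by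
  have hψ : ⇑(testToL2 ψ) =ᵐ[volume.restrict (Ioi (0 : ℝ))] ψ := (memLp_test ψ).coeFn_toLp
  have hA : ⇑(exprToL2 a b V hV φ) =ᵐ[volume.restrict (Ioi (0 : ℝ))] expr a b V φ :=
    (memLp_expr a b hV φ).coeFn_toLp
  rw [MeasureTheory.L2.inner_def]
  refine integral_congr_ae ?_
  filter_upwards [hψ, hA] with r h1 h2
  rw [h1, h2]

theorem integrable_expr_inner (a b : ℝ) {V : ℝ → ℝ} (hV : ContinuousOn V (Ici 0)) (φ ψ : Test) :
    Integrable fun r => ⟪expr a b V φ r, ψ r⟫_ℂ :=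
  ((expr_continuous a b hV φ).inner ψ.continuous).integrable_of_hasCompactSupport
    (hasCompactSupport_of_zero_off ψ fun r hr => by
      rw [(test_zero_off ψ hr).1, inner_zero_right])

theorem quadForm_minimalOp (a b : ℝ) {V : ℝ → ℝ} (hV : ContinuousOn V (Ici 0)) (φ : Test) :
    quadForm (minimalOp a b V hV) ⟨testToL2 φ, LinearMap.mem_range_self _ φ⟩
      = ∫ r in Ioi (0 : ℝ), ⟪expr a b V φ r, φ r⟫_ℝ := by
  rw [quadForm, minimalOp_apply]
  change RCLike.re ⟪exprToL2 a b V hV φ, testToL2 φ⟫_ℂ = _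
  rw [inner_exprToL2_testToL2, ← integral_re (integrable_expr_inner a b hV φ φ).integrableOn]
  rfl

/-- The integrand is the derivative of the compactly supported Wronskian of φ̄ and ψ. This is the
symmetry of -d²/dr² on test functions. -/
theorem integral_wronskian_eq_zero (φ ψ : Test) :
    ∫ r in Ioi (0 : ℝ), (⟪φ r, deriv (deriv ψ) r⟫_ℂ - ⟪deriv (deriv φ) r, ψ r⟫_ℂ) = 0 := by
  have hoff : ∀ r ∉ tsupport φ,
      ⟪φ r, deriv (deriv ψ) r⟫_ℂ - ⟪deriv (deriv φ) r, ψ r⟫_ℂ = 0 := fun r hr => by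
    obtain ⟨h0, -, h2⟩ := test_zero_off φ hr
    rw [h0, h2, inner_zero_left, inner_zero_left, sub_zero]
  have hIoi : ∀ r ∉ Ioi (0 : ℝ),
      ⟪φ r, deriv (deriv ψ) r⟫_ℂ - ⟪deriv (deriv φ) r, ψ r⟫_ℂ = 0 :=
    fun r hr => hoff r fun h => hr (φ.tsupport_subset h)
  rw [setIntegral_eq_integral_of_forall_compl_eq_zero hIoi]
  have c1 : ∀ χ : Test, Continuous (deriv χ) := fun χ => (test_contDiff_deriv χ).continuous
  refine integral_eq_zero_of_hasDerivAt_of_integrable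
    (f := fun r => ⟪φ r, deriv ψ r⟫_ℂ - ⟪deriv φ r, ψ r⟫_ℂ) (fun r => ?_) ?_ ?_
  · have h := ((test_hasDerivAt φ r).inner ℂ (test_hasDerivAt_deriv ψ r)).fun_sub
      ((test_hasDerivAt_deriv φ r).inner ℂ (test_hasDerivAt ψ r))
    exact h.congr_deriv (by ring)
  · exact ((φ.continuous.inner (test_continuous_deriv2 ψ)).sub
      ((test_continuous_deriv2 φ).inner ψ.continuous)).integrable_of_hasCompactSupport
      (hasCompactSupport_of_zero_off φ hoff)
  · refine ((φ.continuous.inner (c1 ψ)).sub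
      ((c1 φ).inner ψ.continuous)).integrable_of_hasCompactSupport
      (hasCompactSupport_of_zero_off φ fun r hr => ?_)
    obtain ⟨h0, h1, -⟩ := test_zero_off φ hr
    simp [h0, h1]

theorem minimalOp_isFormalAdjoint (a b : ℝ) {V : ℝ → ℝ} (hV : ContinuousOn V (Ici 0)) :
    (minimalOp a b V hV).IsFormalAdjoint (minimalOp a b V hV) := by
  rintro ⟨_, φ, rfl⟩ ⟨_, ψ, rfl⟩
  rw [minimalOp_apply, minimalOp_apply]
  change ⟪exprToL2 a b V hV φ, testToL2 ψ⟫_ℂ = ⟪testToL2 φ, exprToL2 a b V hV ψ⟫_ℂ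
  have hconj : Integrable fun r => ⟪φ r, expr a b V ψ r⟫_ℂ :=
    (φ.continuous.inner (expr_continuous a b hV ψ)).integrable_of_hasCompactSupport
      (hasCompactSupport_of_zero_off φ fun r hr => by
        rw [(test_zero_off φ hr).1, inner_zero_left])
  rw [← inner_conj_symm (testToL2 φ), inner_exprToL2_testToL2, inner_exprToL2_testToL2,
    ← integral_conj, ← sub_eq_zero]
  simp only [inner_conj_symm]
  rw [← integral_sub (integrable_expr_inner a b hV φ ψ).integrableOn hconj.integrableOn,
    ← integral_wronskian_eq_zero φ ψ]
  refine integral_congr_ae (Eventually.of_forall fun r => ?_)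
  simp only [expr, RCLike.inner_apply, map_add, map_neg, map_mul, Complex.conj_ofReal]
  ring

/-! ### Restrictions of the adjoint and the closure -/

section Extensions

variable {H : Type*} [NormedAddCommGroup H] [InnerProductSpace ℂ H] [CompleteSpace H]

theorem isFormalAdjoint_of_le_adjoint {T S : H →ₗ.[ℂ] H} (hd : Dense (T.domain : Set H))
    (h : S ≤ T†) : S.IsFormalAdjoint T := fun x y => by
  rw [h.2 (y := ⟨x, h.1 x.2⟩) rfl]
  exact T.adjoint_isFormalAdjoint hd ⟨x, h.1 x.2⟩ y

theorem closure_le_adjoint {T : H →ₗ.[ℂ] H} (hd : Dense (T.domain : Set H))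
    (hsym : T.IsFormalAdjoint T) : T.closure ≤ T† := by
  have hle : T ≤ T† := hsym.le_adjoint hd
  have hcl : T†.IsClosed := T.adjoint_isClosed hd
  refine LinearPMap.le_of_le_graph ?_
  rw [← (hcl.isClosable.leIsClosable hle).graph_closure_eq_closure_graph]
  exact Submodule.topologicalClosure_minimal _ (LinearPMap.le_graph_of_le hle) hcl

/-- Convergence in the graph norm implies form convergence: if φ n and T (φ n) both converge, then
⟪T (φ n - φ m), φ n - φ m⟫ tends to 0. -/
theorem isFormLimit_of_mem_closure {H : Type*} [NormedAddCommGroup H] [InnerProductSpace ℂ H]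
    {T : H →ₗ.[ℂ] H} (hT : T.IsClosable) (x : T.closure.domain) : IsFormLimit T (x : H) := by
  have hx : ((x : H), T.closure x) ∈ closure (T.graph : Set (H × H)) := by
    rw [← Submodule.topologicalClosure_coe, hT.graph_closure_eq_closure_graph]
    exact LinearPMap.mem_graph _ x
  obtain ⟨s, hs, hlim⟩ := mem_closure_iff_seq_limit.1 hx
  choose φ hφ using fun n => (LinearPMap.mem_graph_iff _).1 (hs n)
  have h1 : Tendsto (fun n => (φ n : H)) atTop (𝓝 (x : H)) := by
    simp only [(hφ _).1]
    exact (continuous_fst.tendsto _).comp hlim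
  have h2 : Tendsto (fun n => T (φ n)) atTop (𝓝 (T.closure x)) := by
    simp only [(hφ _).2]
    exact (continuous_snd.tendsto _).comp hlim
  refine ⟨φ, h1, ?_⟩
  have f1 : Tendsto (Prod.fst : ℕ × ℕ → ℕ) atTop atTop := by
    rw [← prod_atTop_atTop_eq]; exact tendsto_fst
  have f2 : Tendsto (Prod.snd : ℕ × ℕ → ℕ) atTop atTop := by
    rw [← prod_atTop_atTop_eq]; exact tendsto_snd
  have h3 := ((h2.comp f1).sub (h2.comp f2)).inner ((h1.comp f1).sub (h1.comp f2)) (𝕜 := ℂ)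
  rw [sub_self, sub_self, inner_zero_left] at h3
  have h4 := (Complex.continuous_re.tendsto _).comp h3
  rw [Complex.zero_re] at h4
  refine h4.congr fun p => ?_
  simp only [quadForm, LinearPMap.map_sub, Submodule.coe_sub, Function.comp_apply]

end Extensions

/-- The number of negative eigenvalues of an operator between the minimal operator and its adjoint
whose domain consists of vectors of the form domain. -/
theorem numNegEigenvalues_le {a b α κ : ℝ} {V q : ℝ → ℝ} (hV : ContinuousOn V (Ici 0))
    (hsb : SemiboundedBelow (minimalOp a b V hV)) (hα : -(1 / 4) < α) (hκ : 1 < κ)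
    (hq : ContinuousOn q (Ioi 0)) (hq0 : ∀ r, 0 < r → 0 ≤ q r)
    (hpot : ∀ r, 0 < r → α / r ^ 2 - q r ≤ potential a b V r) {S : L2 →ₗ.[ℂ] L2}
    (hS : S ≤ (minimalOp a b V hV)†)
    (hSl : ∀ x : S.domain, IsFormLimit (minimalOp a b V hV) (x : L2)) :
    (numNegEigenvalues S : ℝ≥0∞) ≤ ENNReal.ofReal (boundConst α κ) *
      ∫⁻ r in Ioi (0 : ℝ), ENNReal.ofReal (r ^ (2 * κ - 1) * q r ^ κ) := by
  -- The count may be infinite, so the bound is proved for every finite n below it; if the count is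
  -- ⊤, the right side exceeds every natural number.
  have key : ∀ n : ℕ, (n : ℕ∞) ≤ numNegEigenvalues S → (n : ℝ≥0∞) ≤
      ENNReal.ofReal (boundConst α κ) *
        ∫⁻ r in Ioi (0 : ℝ), ENNReal.ofReal (r ^ (2 * κ - 1) * q r ^ κ) := by
    intro n hn
    obtain ⟨v, hv⟩ := exists_quadForm_neg (minimalOp_isFormalAdjoint a b hV) hsb
      (isFormalAdjoint_of_le_adjoint dense_range_testToL2 hS) hSl hn
    choose w hw using fun i => (v i).2
    refine card_le_of_form_neg hV hα hκ hq hq0 hpot w fun c hc => ?_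
    rw [← quadForm_minimalOp a b hV]
    convert hv c hc
    refine Subtype.ext ?_
    simp only [map_sum, map_smul, Submodule.coe_sum, Submodule.coe_smul, hw]
  rcases h : numNegEigenvalues S with _ | n
  · change ((⊤ : ℕ∞) : ℝ≥0∞) ≤ _
    rw [ENat.toENNReal_top, top_le_iff]
    refine ENNReal.eq_top_of_forall_nnreal_le fun x => ?_
    obtain ⟨n, hn⟩ := exists_nat_ge x
    refine le_trans ?_ (key n (by rw [h]; exact le_top))
    exact_mod_cast hn
  · exact key n (by rw [h]; rfl)

end HalfLine

end

theorem theoremA (a b α κ : ℝ) (V Qp Qm : ℝ → ℝ)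
    (ha : -(1 / 4) < a) (ha0 : a ≠ 0) (hb : 0 < b)
    (hV : ContinuousOn V (Set.Ici 0)) (hVb : ∃ M, ∀ r ∈ Set.Ici (0 : ℝ), |V r| ≤ M)
    (hα : -(1 / 4) < α) (hαa : α < a) (hκ : 3 / 2 ≤ κ)
    (hQp : ∀ r, 0 < r → 0 ≤ Qp r) (hQm : ∀ r, 0 < r → 0 ≤ Qm r)
    (hQ : ∀ r, 0 < r → (a - α) / r ^ 2 + b * r ^ 2 + V r = Qp r - Qm r)
    (𝒜 : HalfLine.L2 →ₗ.[ℂ] HalfLine.L2)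
    (h𝒜 : 𝒜 = HalfLine.friedrichs (HalfLine.minimalOp a b V hV)
            (HalfLine.minimalOp_semibounded ha hb hV hVb) ∨
          (IsSelfAdjoint (HalfLine.minimalOp a b V hV).closure ∧
            𝒜 = (HalfLine.minimalOp a b V hV).closure)) :
    (HalfLine.numNegEigenvalues 𝒜 : ℝ≥0∞) ≤
      ENNReal.ofReal ((κ - 1) ^ (κ - 1) * Real.Gamma (2 * κ) /
          ((4 * α + 1) ^ (κ - 1 / 2) * κ ^ κ * Real.Gamma κ ^ 2)) *
        ∫⁻ r in Set.Ioi (0 : ℝ), ENNReal.ofReal (r ^ (2 * κ - 1) * Qm r ^ κ) := by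
  have hκ1 : 1 < κ := by linarith
  -- This is the negative part of Q. It is continuous and is the smallest admissible choice of Q₋,
  -- so the bound for q implies the one for `Qm`, which need not be continuous.
  set q : ℝ → ℝ := fun r => max (-((a - α) / r ^ 2 + b * r ^ 2 + V r)) 0 with hq
  have hqc : ContinuousOn q (Set.Ioi 0) :=
    ContinuousOn.sup (HalfLine.potential_continuousOn (a - α) b hV).neg continuousOn_const
  have hpot : ∀ r, 0 < r → α / r ^ 2 - q r ≤ HalfLine.potential a b V r := fun r _ => by
    have h1 := le_max_left (-((a - α) / r ^ 2 + b * r ^ 2 + V r)) 0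
    have h2 : (a - α) / r ^ 2 = a / r ^ 2 - α / r ^ 2 := sub_div _ _ _
    simp only [hq, HalfLine.potential]
    linarith
  have hqQ : ∀ r, 0 < r → q r ≤ Qm r := fun r hr =>
    max_le (by linarith [hQ r hr, hQp r hr]) (hQm r hr)
  set T := HalfLine.minimalOp a b V hV with hT
  have hd : Dense (T.domain : Set HalfLine.L2) := HalfLine.dense_range_testToL2
  have hsym : T.IsFormalAdjoint T := HalfLine.minimalOp_isFormalAdjoint a b hV
  -- These are the only two properties of 𝒜 that the eigenvalue bound needs, and each alternative
  -- for 𝒜 provides both.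
  have hext : 𝒜 ≤ T† ∧ ∀ x : 𝒜.domain, HalfLine.IsFormLimit T (x : HalfLine.L2) := by
    rcases h𝒜 with rfl | ⟨-, rfl⟩
    · exact ⟨LinearPMap.domRestrict_le, fun x => x.2.1⟩
    · exact ⟨HalfLine.closure_le_adjoint hd hsym, HalfLine.isFormLimit_of_mem_closure
        ((T.adjoint_isClosed hd).isClosable.leIsClosable (hsym.le_adjoint hd))⟩
  refine (HalfLine.numNegEigenvalues_le hV (HalfLine.minimalOp_semibounded ha hb hV hVb) hα hκ1
    hqc (fun r _ => le_max_right _ _) hpot hext.1 hext.2).trans ?_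
  rw [HalfLine.boundConst]
  gcongr ENNReal.ofReal _ * ?_
  refine MeasureTheory.setLIntegral_mono' measurableSet_Ioi fun r hr => ENNReal.ofReal_le_ofReal ?_
  have hr0 : (0 : ℝ) < r := hr
  exact mul_le_mul_of_nonneg_left
    (Real.rpow_le_rpow (le_max_right _ _) (hqQ r hr0) (by linarith)) (by positivity)
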